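/- Conventions. All spaces are over $\mathbb F=\mathbb R$ or $\mathbb C$. A quasi-Banach space $X$ is a vector space with a quasi-norm (positive on non-zero vectors, absolutely homogeneous, $\|f+g\|\le\kappa(\|f\|+\|g\|)$ for some $\kappa\ge1$) for which it is complete; the least such $\kappa\geq 1$ is its modulus of concavity. A countable family $(x_n)_{n\in N}$ is an unconditional basic sequence if every $f$ in its closed linear span $[x_n\colon n\in N]$ has a unique expansion $f=\sum_{n} a_n x_n$ converging unconditionally. It is a $K$-unconditional basis of $X$ if moreover its closed span is $X$ and $\|\sum a_nx_n\|\le K\|\sum b_nx_n\|$ for all finitely supported scalar families with $|a_n|\le|b_n|$; then $x_n^*(f)=a_n$ denote the coefficients, $\operatorname{supp}(f)=\{n\colon x_n^*(f)\ne0\}$, and $\operatorname{supp}(f^*)=\{n\colon f^*(x_n)\neq 0\}$ for $f^*\in X^*$. A family is normalized if all its vectors have quasi-norm $1$. Given $\alpha\colon(0,\infty)\to(0,\infty)$, the basis is strongly absolute with function $\alpha$ if $$\sum_{n}|x_n^*(f)|\,\|x_n\|\le\max\Big\{\alpha(R)\sup_n|x_n^*(f)|\,\|x_n\|,\ \frac{\|f\|}{R}\Big\},\qquad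 f\in X,\ R>0.$$ Two families $(y_m)_{m\in M}$, $(z_m)_{m\in M}$ are $C$-equivalent ($C\ge 1$) if there is a linear isomorphic embedding $T$ defined on $[y_m\colon m\in M]$ with $T(y_m)=z_m$ for all $m$, $\|T\|\le C$ and $\|T^{-1}\|\le C$. An unconditional basic sequence $(y_m)_{m\in M}$ in a space with unconditional basis $(x_n)_{n\in N}$ is well $C$-complemented if its closed span is complemented, the sets $\operatorname{supp}(y_m)$ are finite and pairwise disjoint, and there are $y_m^*\in X^*$ with $y_m^*(y_{m'})=\delta_{m,m'}$ and $\operatorname{supp}(y_m^*)\subseteq\operatorname{supp}(y_m)$ such that $f\mapsto\sum_m y_m^*(f)y_m$ is (unconditionally convergent and) a bounded linear map on $X$ and $\|\sum_{m\in A}y_m^*(f)y_m\|\le C$ for all $A\subseteq M$ and all $\|f\|\le1$. A normalized unconditional basis $(x_n)_{n\in N}$ is uniformly universal for well complemented block basic sequences if there is a function $\eta\colon[1,\infty)\to[1,\infty)$ such that for every $C\ge1$ and every normalized well $C$-complemented basic sequence $(y_m)_{m\in M}$ there is a map $\pi\colon M\to N$ with $\pi(m)\in\operatorname{supp}(y_m)$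 for all $m\in M$ and such that $(y_m)_{m\in M}$ is $\eta(C)$-equivalent to $(x_{\pi(m)})_{m\in M}$. Theorem. Let $J$ be a countable set, let $K\ge 1$ and $\kappa$ be constants, and let $\alpha\colon(0,\infty)\to(0,\infty)$ be a function. For each $j\in J$ let $\mathcal X_j=(x_{j,n})_{n\in N_j}$ be a normalized $K$-unconditional basis, indexed by a countable set $N_j$, of a quasi-Banach space $X_j$ with modulus of concavity at most $\kappa$, and suppose that every $\mathcal X_j$ is strongly absolute with the same function $\alpha$. Let $X=(\bigoplus_{j\in J}X_j)_{\ell_1}$ be the space of all $f=(f_j)_{j\in J}\in\prod_j X_j$ with $\|f\|=\sum_{j}\|f_j\|<\infty$, and let $L_j\colon X_j\to X$ be the canonical embeddings. Then $X$ is a quasi-Banach space, the family $\mathcal X=(L_j(x_{j,n}))_{j\in J,\,n\in N_j}$ is a normalized $K$-unconditional basis of $X$, and $\mathcal X$ is uniformly universal for well complemented block basic sequences. -/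

import Mathlib

open Filter Topology

universe w

noncomputable section

/-- `‖·‖` is a quasi-norm on the `𝕜`-vector space `X`; nonnegativity and `‖0‖ = 0` follow. -/
class IsQuasiNormed (𝕜 : Type*) (X : Type*) [RCLike 𝕜] [AddCommGroup X] [Module 𝕜 X] [Norm X] :
    Prop where
  norm_pos : ∀ f : X, f ≠ 0 → 0 < ‖f‖
  norm_smul : ∀ (t : 𝕜) (f : X), ‖t • f‖ = ‖t‖ * ‖f‖
  exists_concavity : ∃ κ : ℝ, 1 ≤ κ ∧ ∀ f g : X, ‖f + g‖ ≤ κ * (‖f‖ + ‖g‖)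

/-- A quasi-Banach space: a quasi-normed space in which every Cauchy sequence converges.
(The sets `{g | ‖f - g‖ < ε}` form a neighbourhood base at `f` for the metrizable vector topology
induced by the quasi-norm.) -/
class IsQuasiBanach (𝕜 : Type*) (X : Type*) [RCLike 𝕜] [AddCommGroup X] [Module 𝕜 X] [Norm X] :
    Prop extends IsQuasiNormed 𝕜 X where
  complete : ∀ u : ℕ → X, (∀ ε > 0, ∃ k, ∀ m ≥ k, ∀ n ≥ k, ‖u m - u n‖ < ε) →
    ∃ f : X, Tendsto (fun n => ‖u n - f‖) atTop (𝓝 0)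

/-- The modulus of concavity: the optimal `κ ≥ 1` with `‖f + g‖ ≤ κ (‖f‖ + ‖g‖)`. -/
def modulusOfConcavity (X : Type*) [AddCommGroup X] [Norm X] : ℝ :=
  sInf {κ : ℝ | 1 ≤ κ ∧ ∀ f g : X, ‖f + g‖ ≤ κ * (‖f‖ + ‖g‖)}

section QuasiNormed

variable {𝕜 : Type*} {X : Type*} [RCLike 𝕜] [AddCommGroup X] [Module 𝕜 X] [Norm X]

theorem IsQuasiNormed.norm_zero_eq (𝕜 : Type*) {X : Type*} [RCLike 𝕜] [AddCommGroup X]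
    [Module 𝕜 X] [Norm X] [IsQuasiNormed 𝕜 X] : ‖(0 : X)‖ = 0 := by
  have h := IsQuasiNormed.norm_smul (0 : 𝕜) (0 : X)
  simpa using h

theorem IsQuasiNormed.norm_nonneg' (𝕜 : Type*) {X : Type*} [RCLike 𝕜] [AddCommGroup X]
    [Module 𝕜 X] [Norm X] [IsQuasiNormed 𝕜 X] (f : X) : 0 ≤ ‖f‖ := by
  by_cases hf : f = 0
  · rw [hf, IsQuasiNormed.norm_zero_eq 𝕜]
  · exact (IsQuasiNormed.norm_pos (𝕜 := 𝕜) f hf).le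

theorem IsQuasiNormed.norm_add_le_of_modulus_le (𝕜 : Type*) {X : Type*} [RCLike 𝕜]
    [AddCommGroup X] [Module 𝕜 X] [Norm X] [IsQuasiNormed 𝕜 X] {κ : ℝ}
    (h : modulusOfConcavity X ≤ κ) (f g : X) : ‖f + g‖ ≤ κ * (‖f‖ + ‖g‖) := by
  have hs : 0 ≤ ‖f‖ + ‖g‖ :=
    add_nonneg (IsQuasiNormed.norm_nonneg' 𝕜 f) (IsQuasiNormed.norm_nonneg' 𝕜 g)
  refine le_trans ?_ (mul_le_mul_of_nonneg_right h hs)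
  rcases hs.eq_or_lt with h0 | h0
  · obtain ⟨κ', _, h'⟩ := IsQuasiNormed.exists_concavity (𝕜 := 𝕜) (X := X)
    simpa [← h0] using h' f g
  · rw [← div_le_iff₀ h0]
    refine le_csInf (IsQuasiNormed.exists_concavity (𝕜 := 𝕜) (X := X)) ?_
    rintro b ⟨_, hb⟩
    rw [div_le_iff₀ h0]
    exact hb f g

/-- The closed linear span `[x n : n ∈ N]`. -/
def closedSpan (𝕜 : Type*) {X N : Type*} [RCLike 𝕜] [AddCommGroup X] [Module 𝕜 X] [Norm X]
    [IsQuasiNormed 𝕜 X] (x : N → X) : Submodule 𝕜 X where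
  carrier := {f | ∀ ε > 0, ∃ g ∈ Submodule.span 𝕜 (Set.range x), ‖f - g‖ < ε}
  zero_mem' := fun ε hε => ⟨0, Submodule.zero_mem _, by
    simpa [IsQuasiNormed.norm_zero_eq 𝕜] using hε⟩
  add_mem' := by
    intro f₁ f₂ h₁ h₂ ε hε
    obtain ⟨κ, hκ, h⟩ := IsQuasiNormed.exists_concavity (𝕜 := 𝕜) (X := X)
    have hκ0 : 0 < κ := by linarith
    obtain ⟨g₁, hg₁, h₁⟩ := h₁ (ε / (2 * κ)) (by positivity)
    obtain ⟨g₂, hg₂, h₂⟩ := h₂ (ε / (2 * κ)) (by positivity)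
    refine ⟨g₁ + g₂, Submodule.add_mem _ hg₁ hg₂, ?_⟩
    rw [add_sub_add_comm]
    calc _ ≤ κ * (‖f₁ - g₁‖ + ‖f₂ - g₂‖) := h _ _
      _ < κ * (ε / (2 * κ) + ε / (2 * κ)) := by gcongr
      _ = ε := by field_simp; ring
  smul_mem' := by
    intro c f hf ε hε
    by_cases hc : c = 0
    · exact ⟨0, Submodule.zero_mem _, by simpa [hc, IsQuasiNormed.norm_zero_eq 𝕜] using hε⟩
    · have hc0 : 0 < ‖c‖ := norm_pos_iff.2 hc
      obtain ⟨g, hg, h⟩ := hf (ε / ‖c‖) (by positivity)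
      refine ⟨c • g, Submodule.smul_mem _ _ hg, ?_⟩
      rw [← smul_sub, IsQuasiNormed.norm_smul, mul_comm]
      exact (lt_div_iff₀ hc0).1 h

/-- The series `∑ n, a n • x n` converges unconditionally to `f`. -/
def HasExpansion {N : Type*} (x : N → X) (a : N → 𝕜) (f : X) : Prop :=
  Tendsto (fun s : Finset N => ‖f - ∑ n ∈ s, a n • x n‖) atTop (𝓝 0)

open Classical in
/-- The coefficient transform `f ↦ (xₙ*(f))ₙ` with respect to an unconditional basis `x`
(junk value `0` where there is no expansion; for a basis the expansion exists and is unique). -/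
def coeff (𝕜 : Type*) {X N : Type*} [RCLike 𝕜] [AddCommGroup X] [Module 𝕜 X] [Norm X]
    (x : N → X) (f : X) : N → 𝕜 :=
  if h : ∃ a : N → 𝕜, HasExpansion x a f then h.choose else 0

def IsUnconditionalBasicSeq (𝕜 : Type*) {X N : Type*} [RCLike 𝕜] [AddCommGroup X] [Module 𝕜 X]
    [Norm X] [IsQuasiNormed 𝕜 X] (x : N → X) : Prop :=
  ∀ f ∈ closedSpan 𝕜 x, ∃! a : N → 𝕜, HasExpansion x a f

/-- `x` is a `K`-unconditional basis of `X`. -/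
structure IsUnconditionalBasis (𝕜 : Type*) {X N : Type*} [RCLike 𝕜] [AddCommGroup X] [Module 𝕜 X]
    [Norm X] [IsQuasiNormed 𝕜 X] (K : ℝ) (x : N → X) : Prop where
  basicSeq : IsUnconditionalBasicSeq 𝕜 x
  closedSpan_eq_top : closedSpan 𝕜 x = ⊤
  one_le : 1 ≤ K
  norm_sum_le : ∀ (s : Finset N) (a b : N → 𝕜), (∀ n ∈ s, ‖a n‖ ≤ ‖b n‖) →
    ‖∑ n ∈ s, a n • x n‖ ≤ K * ‖∑ n ∈ s, b n • x n‖

def IsNormalizedFamily {X N : Type*} [Norm X] (x : N → X) : Prop :=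
  ∀ n, ‖x n‖ = 1

/-- The support of the vector `f` with respect to the basis `x`. -/
def vecSupport (𝕜 : Type*) {X N : Type*} [RCLike 𝕜] [AddCommGroup X] [Module 𝕜 X] [Norm X]
    (x : N → X) (f : X) : Set N :=
  {n | coeff 𝕜 x f n ≠ 0}

/-- The support of the functional `φ` with respect to the basis `x`. -/
def funSupport {N : Type*} (x : N → X) (φ : X →ₗ[𝕜] 𝕜) : Set N :=
  {n | φ (x n) ≠ 0}

/-- `x` is strongly absolute with function `α : (0,∞) → (0,∞)`; both sides are read in `[0,∞]`, so
that the finiteness of the sum on the left is part of the assertion. -/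
def IsStronglyAbsolute (𝕜 : Type*) {X N : Type*} [RCLike 𝕜] [AddCommGroup X] [Module 𝕜 X] [Norm X]
    (α : ℝ → ℝ) (x : N → X) : Prop :=
  ∀ R > 0, 0 < α R ∧ ∀ f : X,
    ∑' n, ENNReal.ofReal (‖coeff 𝕜 x f n‖ * ‖x n‖) ≤
      max (ENNReal.ofReal (α R) * ⨆ n, ENNReal.ofReal (‖coeff 𝕜 x f n‖ * ‖x n‖))
        (ENNReal.ofReal (‖f‖ / R))

/-- Bounded linear maps. -/
def IsBoundedMap {Y : Type*} [AddCommGroup Y] [Module 𝕜 Y] [Norm Y] (T : X →ₗ[𝕜] Y) : Prop :=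
  ∃ c : ℝ, ∀ f, ‖T f‖ ≤ c * ‖f‖

/-- The families `x` and `y` are `C`-equivalent: there is a linear isomorphic embedding
`T : [x] → Y` with `T (x n) = y n`, `‖T‖ ≤ C` and `‖T⁻¹‖ ≤ C`. -/
def AreEquivalent (𝕜 : Type*) {X Y N : Type*} [RCLike 𝕜] [AddCommGroup X] [Module 𝕜 X] [Norm X]
    [IsQuasiNormed 𝕜 X] [AddCommGroup Y] [Module 𝕜 Y] [Norm Y]
    (C : ℝ) (x : N → X) (y : N → Y) : Prop :=
  1 ≤ C ∧ ∃ T : closedSpan 𝕜 x →ₗ[𝕜] Y,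
    (∀ (n : N) (hn : x n ∈ closedSpan 𝕜 x), T ⟨x n, hn⟩ = y n) ∧
    ∀ f : closedSpan 𝕜 x, ‖T f‖ ≤ C * ‖(f : X)‖ ∧ ‖(f : X)‖ ≤ C * ‖T f‖

/-- The closed linear span of `y` is a complemented subspace. -/
def IsComplementedFamily (𝕜 : Type*) {X M : Type*} [RCLike 𝕜] [AddCommGroup X] [Module 𝕜 X]
    [Norm X] [IsQuasiNormed 𝕜 X] (y : M → X) : Prop :=
  ∃ P : X →ₗ[𝕜] X, IsBoundedMap P ∧ (∀ f, P f ∈ closedSpan 𝕜 y) ∧ ∀ f ∈ closedSpan 𝕜 y, P f = f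

/-- `ystar` is a family of projecting functionals for `y`. -/
structure IsProjecting {M : Type*} (y : M → X) (ystar : M → X →ₗ[𝕜] 𝕜) : Prop where
  bounded : ∀ m, IsBoundedMap (ystar m)
  biorthogonal : ∀ m, ystar m (y m) = 1 ∧ ∀ m', m' ≠ m → ystar m (y m') = 0
  projection : ∃ P : X →ₗ[𝕜] X, IsBoundedMap P ∧ ∀ f, HasExpansion y (fun m => ystar m f) (P f)

/-- `Γ[y, ystar] ≤ C`: for every subset `A` of the index set and every `f` in the unit ball, the
norm of `∑ m ∈ A, ystar m f • y m` is at most `C`. -/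
def ProjectionBound {M : Type*} (C : ℝ) (y : M → X) (ystar : M → X →ₗ[𝕜] 𝕜) : Prop :=
  ∀ (A : Set M) (f : X), ‖f‖ ≤ 1 →
    ∃ g : X, HasExpansion y (A.indicator fun m => ystar m f) g ∧ ‖g‖ ≤ C

/-- The unconditional basic sequence `y` is well `C`-complemented with respect to the basis `x`. -/
structure IsWellComplemented (𝕜 : Type*) {X N M : Type*} [RCLike 𝕜] [AddCommGroup X] [Module 𝕜 X]
    [Norm X] [IsQuasiNormed 𝕜 X] (C : ℝ) (x : N → X) (y : M → X) : Prop where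
  basicSeq : IsUnconditionalBasicSeq 𝕜 y
  complemented : IsComplementedFamily 𝕜 y
  finite_support : ∀ m, (vecSupport 𝕜 x (y m)).Finite
  disjoint_support : Pairwise fun m m' => Disjoint (vecSupport 𝕜 x (y m)) (vecSupport 𝕜 x (y m'))
  exists_good : ∃ ystar : M → X →ₗ[𝕜] 𝕜, IsProjecting y ystar ∧
    (∀ m, funSupport x (ystar m) ⊆ vecSupport 𝕜 x (y m)) ∧ ProjectionBound C y ystar

/-- The normalized unconditional basis `x` is uniformly universal for well complemented block basic
sequences (index sets of the block basic sequences are taken in an arbitrary universe `v`). -/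
def IsUniformlyUniversal.{v, u₁, u₂, u₃} (𝕜 : Type u₁) {X : Type u₂} {N : Type u₃} [RCLike 𝕜]
    [AddCommGroup X] [Module 𝕜 X] [Norm X] [IsQuasiNormed 𝕜 X] (x : N → X) : Prop :=
  ∃ η : ℝ → ℝ, (∀ C, 1 ≤ C → 1 ≤ η C) ∧
    ∀ C, 1 ≤ C → ∀ (M : Type v) [Countable M] (y : M → X),
      IsNormalizedFamily y → IsWellComplemented 𝕜 C x y →
        ∃ π : M → N, (∀ m, π m ∈ vecSupport 𝕜 x (y m)) ∧
          AreEquivalent 𝕜 (η C) y (fun m => x (π m))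

end QuasiNormed

section DirectSum

variable (𝕜 : Type*) {J : Type*} (X : J → Type*) [RCLike 𝕜] [∀ j, AddCommGroup (X j)]
  [∀ j, Module 𝕜 (X j)] [∀ j, Norm (X j)] [∀ j, IsQuasiNormed 𝕜 (X j)]

/-- The `ℓ₁`-sum of quasi-normed spaces with moduli of concavity bounded by `κ`. -/
def l1Sum (κ : ℝ) (hκ : ∀ j, modulusOfConcavity (X j) ≤ κ) : Submodule 𝕜 (∀ j, X j) where
  carrier := {f | Summable fun j => ‖f j‖}
  zero_mem' := by
    simp [IsQuasiNormed.norm_zero_eq 𝕜, summable_zero]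
  add_mem' := by
    intro f g hf hg
    exact Summable.of_nonneg_of_le (fun j => IsQuasiNormed.norm_nonneg' 𝕜 _)
      (fun j => IsQuasiNormed.norm_add_le_of_modulus_le 𝕜 (hκ j) (f j) (g j))
      ((Summable.add hf hg).mul_left κ)
  smul_mem' := by
    intro c f hf
    simpa [IsQuasiNormed.norm_smul] using Summable.mul_left ‖c‖ hf

variable {X} {κ : ℝ} {hκ : ∀ j, modulusOfConcavity (X j) ≤ κ}

instance l1SumNorm : Norm (l1Sum 𝕜 X κ hκ) := ⟨fun f => ∑' j, ‖f.1 j‖⟩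

instance l1SumIsQuasiNormed : IsQuasiNormed 𝕜 (l1Sum 𝕜 X κ hκ) where
  norm_pos := by
    intro f hf
    have : ∃ j, f.1 j ≠ 0 := by
      by_contra! h
      exact hf (Subtype.ext (funext h))
    obtain ⟨j, hj⟩ := this
    exact Summable.tsum_pos f.2 (fun j => IsQuasiNormed.norm_nonneg' 𝕜 _) j
      (IsQuasiNormed.norm_pos (𝕜 := 𝕜) _ hj)
  norm_smul := by
    intro t f
    change ∑' j, ‖t • f.1 j‖ = ‖t‖ * ∑' j, ‖f.1 j‖
    simp [IsQuasiNormed.norm_smul, tsum_mul_left]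
  exists_concavity := by
    refine ⟨max κ 1, le_max_right _ _, fun f g => ?_⟩
    change ∑' j, ‖f.1 j + g.1 j‖ ≤ max κ 1 * (∑' j, ‖f.1 j‖ + ∑' j, ‖g.1 j‖)
    rw [← Summable.tsum_add f.2 g.2, ← tsum_mul_left]
    exact Summable.tsum_le_tsum
      (fun j => IsQuasiNormed.norm_add_le_of_modulus_le 𝕜 ((hκ j).trans (le_max_left _ _)) _ _)
      (f + g).2 ((Summable.add f.2 g.2).mul_left _)

open Classical in
/-- The canonical embedding `L_j` of `X j` into the `ℓ₁`-sum. -/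
def l1Embed (hκ : ∀ j, modulusOfConcavity (X j) ≤ κ) (j : J) (v : X j) : l1Sum 𝕜 X κ hκ :=
  ⟨Pi.single j v, summable_of_ne_finset_zero (s := {j}) fun i hi => by
    rw [Pi.single_eq_of_ne (by simpa using hi), IsQuasiNormed.norm_zero_eq 𝕜]⟩

/-- The family `(L_j (x j n))` in the `ℓ₁`-sum, indexed by the pairs `(j, n)`. -/
def l1SumBasis {N : J → Type*} (hκ : ∀ j, modulusOfConcavity (X j) ≤ κ)
    (x : ∀ j, N j → X j) : (Σ j, N j) → l1Sum 𝕜 X κ hκ :=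
  fun p => l1Embed 𝕜 hκ p.1 (x p.1 p.2)

end DirectSum

end

/-! Quasi-Banach and basis properties of the `ℓ₁`-sum are checked coordinatewise. For universality,
call `j` the colour of `(j, n)`. The sum enters only through three estimates, collected in
`IsL1Decomposition`: basis vectors of distinct colours have an upper `ℓ₁`-estimate, all coefficient
families have a lower `ℓ₁`-estimate, and strong absoluteness can be added over the colours.

Let `y m = ∑ a m n • x n`. The identity `∑ a m n * ystar m (x n) = 1` and strong absoluteness give a
set `G m` in the support where `ystar m (x n)` is bounded below and `∑ ‖a m n‖ ≥ θ`
(`exists_large_part`). For any choice `π m ∈ G m`, the projection maps suitable multiples of `x (π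
m)` to `y m`, so `y` is dominated by the `x (π m)`.

The reverse domination restricts the choice. If some coefficient on `G m` exceeds `δ`, its index is
taken and unconditionality suffices. For the remaining, flat blocks, distinct colours suffice: then
`‖∑ c m • x (π m)‖ ≤ ∑ ‖c m‖`, while the lower `ℓ₁`-estimate gives `θ * ∑ ‖c m‖ ≤ L * ‖∑ c m • y
m‖`. Distinct colours come from Hall's theorem (`exists_injOn_colour`): if the flat blocks in `F`
had fewer than `F.card` colours in all, strong absoluteness would make `‖∑ m ∈ F, y m‖` too large
compared with its upper bound `B * κ * F.card`. -/

/-! ### Arithmetic of quasi-norms. -/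

namespace IsQuasiNormed

theorem norm_neg_eq (𝕜 : Type*) {X : Type*} [RCLike 𝕜] [AddCommGroup X] [Module 𝕜 X] [Norm X]
    [IsQuasiNormed 𝕜 X] (f : X) : ‖-f‖ = ‖f‖ := by
  have h := IsQuasiNormed.norm_smul (-1 : 𝕜) f
  simpa using h

theorem norm_sub_comm (𝕜 : Type*) {X : Type*} [RCLike 𝕜] [AddCommGroup X] [Module 𝕜 X] [Norm X]
    [IsQuasiNormed 𝕜 X] (f g : X) : ‖f - g‖ = ‖g - f‖ := by
  rw [← norm_neg_eq 𝕜, neg_sub]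

theorem eq_zero_of_norm_le_zero (𝕜 : Type*) {X : Type*} [RCLike 𝕜] [AddCommGroup X] [Module 𝕜 X]
    [Norm X] [IsQuasiNormed 𝕜 X] {f : X} (h : ‖f‖ ≤ 0) : f = 0 := by
  by_contra hf
  exact absurd (IsQuasiNormed.norm_pos (𝕜 := 𝕜) f hf) (not_lt.2 h)

theorem norm_sub_le_of_concavity (𝕜 : Type*) {X : Type*} [RCLike 𝕜] [AddCommGroup X] [Module 𝕜 X]
    [Norm X] [IsQuasiNormed 𝕜 X] {κ : ℝ} (hκ : ∀ f g : X, ‖f + g‖ ≤ κ * (‖f‖ + ‖g‖)) (f g : X) :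
    ‖f - g‖ ≤ κ * (‖f‖ + ‖g‖) := by
  rw [sub_eq_add_neg]
  simpa [norm_neg_eq 𝕜] using hκ f (-g)

/-- Two vectors that can be approximated simultaneously agree. -/
theorem eq_of_forall_approx (𝕜 : Type*) {X : Type*} [RCLike 𝕜] [AddCommGroup X] [Module 𝕜 X]
    [Norm X] [IsQuasiNormed 𝕜 X] {f g : X}
    (h : ∀ ε > 0, ∃ v : X, ‖f - v‖ < ε ∧ ‖g - v‖ < ε) : f = g := by
  obtain ⟨κ, hκ, hc⟩ := IsQuasiNormed.exists_concavity (𝕜 := 𝕜) (X := X)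
  have hκ0 : 0 < κ := by linarith
  rw [← sub_eq_zero]
  refine eq_zero_of_norm_le_zero 𝕜 (le_of_forall_pos_le_add fun ε hε => ?_)
  obtain ⟨v, h₁, h₂⟩ := h (ε / (2 * κ)) (by positivity)
  calc ‖f - g‖ = ‖(f - v) - (g - v)‖ := by rw [sub_sub_sub_cancel_right]
    _ ≤ κ * (‖f - v‖ + ‖g - v‖) := norm_sub_le_of_concavity 𝕜 hc _ _
    _ ≤ κ * (ε / (2 * κ) + ε / (2 * κ)) := by gcongr
    _ = 0 + ε := by field_simp; ring

theorem norm_le_of_approx (𝕜 : Type*) {X : Type*} [RCLike 𝕜] [AddCommGroup X] [Module 𝕜 X]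
    [Norm X] [IsQuasiNormed 𝕜 X] {κ : ℝ} (hκ : ∀ f g : X, ‖f + g‖ ≤ κ * (‖f‖ + ‖g‖)) (f v : X) :
    ‖f‖ ≤ κ * (‖f - v‖ + ‖v‖) ∧ ‖v‖ ≤ κ * (‖f - v‖ + ‖f‖) := by
  constructor
  · simpa using hκ (f - v) v
  · rw [norm_sub_comm 𝕜]
    simpa using hκ (v - f) f

end IsQuasiNormed

/-! ### Unconditional expansions and strong absoluteness for finite sums. -/

section Expansions

variable {𝕜 : Type*} {X : Type*} [RCLike 𝕜] [AddCommGroup X] [Module 𝕜 X] [Norm X]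

theorem hasExpansion_iff [IsQuasiNormed 𝕜 X] {N : Type*} {x : N → X} {a : N → 𝕜} {f : X} :
    HasExpansion x a f ↔
      ∀ ε > 0, ∃ s₀ : Finset N, ∀ s, s₀ ⊆ s → ‖f - ∑ n ∈ s, a n • x n‖ < ε := by
  classical
  unfold HasExpansion
  rw [Metric.tendsto_atTop]
  simp [abs_of_nonneg (IsQuasiNormed.norm_nonneg' 𝕜 _)]

theorem HasExpansion.unique [IsQuasiNormed 𝕜 X] {N : Type*} {x : N → X} {a : N → 𝕜} {f g : X}
    (hf : HasExpansion x a f) (hg : HasExpansion x a g) : f = g := by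
  classical
  rw [hasExpansion_iff] at hf hg
  refine IsQuasiNormed.eq_of_forall_approx 𝕜 fun ε hε => ?_
  obtain ⟨s, hs⟩ := hf ε hε
  obtain ⟨t, ht⟩ := hg ε hε
  exact ⟨_, hs (s ∪ t) Finset.subset_union_left, ht (s ∪ t) Finset.subset_union_right⟩

theorem hasExpansion_sum [IsQuasiNormed 𝕜 X] {N : Type*} {x : N → X} {a : N → 𝕜} (s : Finset N)
    (ha : ∀ n ∉ s, a n = 0) : HasExpansion x a (∑ n ∈ s, a n • x n) := by
  rw [hasExpansion_iff]
  intro ε hε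
  refine ⟨s, fun t hst => ?_⟩
  rw [Finset.sum_subset hst fun n _ hn => by rw [ha n hn, zero_smul], sub_self,
    IsQuasiNormed.norm_zero_eq 𝕜]
  exact hε

theorem mem_closedSpan_of_hasExpansion [IsQuasiNormed 𝕜 X] {N : Type*} {x : N → X} {a : N → 𝕜}
    {f : X} (h : HasExpansion x a f) : f ∈ closedSpan 𝕜 x := by
  intro ε hε
  obtain ⟨s, hs⟩ := hasExpansion_iff.1 h ε hε
  exact ⟨_, Submodule.sum_mem _ fun n _ => Submodule.smul_mem _ _
    (Submodule.subset_span ⟨n, rfl⟩), hs s subset_rfl⟩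

namespace IsUnconditionalBasis

variable [IsQuasiNormed 𝕜 X] {N : Type*} {x : N → X} {K : ℝ}

theorem hasExpansion_coeff (hx : IsUnconditionalBasis 𝕜 K x) (f : X) :
    HasExpansion x (coeff 𝕜 x f) f := by
  have h : ∃ a : N → 𝕜, HasExpansion x a f :=
    (hx.basicSeq f (by rw [hx.closedSpan_eq_top]; trivial)).exists
  rw [coeff, dif_pos h]
  exact h.choose_spec

theorem coeff_eq (hx : IsUnconditionalBasis 𝕜 K x) {f : X} {a : N → 𝕜} (h : HasExpansion x a f) :
    coeff 𝕜 x f = a :=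
  (hx.basicSeq f (by rw [hx.closedSpan_eq_top]; trivial)).unique (hx.hasExpansion_coeff f) h

open Classical in
theorem coeff_sum (hx : IsUnconditionalBasis 𝕜 K x) (s : Finset N) (a : N → 𝕜) :
    coeff 𝕜 x (∑ n ∈ s, a n • x n) = fun n => if n ∈ s then a n else 0 := by
  refine hx.coeff_eq ?_
  have := hasExpansion_sum (x := x) (a := fun n => if n ∈ s then a n else 0) s
    fun n hn => by simp [hn]
  rwa [Finset.sum_congr rfl fun n hn => by rw [if_pos hn]] at this

theorem eq_sum_of_finite_support (hx : IsUnconditionalBasis 𝕜 K x) {f : X}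
    (hf : (vecSupport 𝕜 x f).Finite) : f = ∑ n ∈ hf.toFinset, coeff 𝕜 x f n • x n :=
  (hx.hasExpansion_coeff f).unique (hasExpansion_sum _ fun n hn => by
    simpa [vecSupport] using hn)

theorem norm_sum_subset_le (hx : IsUnconditionalBasis 𝕜 K x) {s t : Finset N} (hst : s ⊆ t)
    (a : N → 𝕜) : ‖∑ n ∈ s, a n • x n‖ ≤ K * ‖∑ n ∈ t, a n • x n‖ := by
  classical
  have h := hx.norm_sum_le t (fun n => if n ∈ s then a n else 0) a fun n _ => by
    split_ifs <;> simp
  rwa [← Finset.sum_subset hst fun n _ hn => by simp [hn],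
    Finset.sum_congr rfl fun n hn => by rw [if_pos hn]] at h

theorem norm_sum_comp_le (hx : IsUnconditionalBasis 𝕜 K x) {M : Type*} {π : M → N}
    (hπ : Function.Injective π) (F : Finset M) {a b : M → 𝕜} (hab : ∀ m ∈ F, ‖a m‖ ≤ ‖b m‖) :
    ‖∑ m ∈ F, a m • x (π m)‖ ≤ K * ‖∑ m ∈ F, b m • x (π m)‖ := by
  have h := hx.norm_sum_le (F.map ⟨π, hπ⟩) (Function.extend π a 0) (Function.extend π b 0) (by
    simpa [hπ.extend_apply] using hab)
  simpa [Finset.sum_map, hπ.extend_apply] using h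

/-- Suppression of coefficients costs `K` among finite sums, and passing from `f` to a nearby finite
sum costs `κ`. This uniform bound plays the dominating role in the `ℓ₁`-sum. -/
theorem norm_partialSum_le (hx : IsUnconditionalBasis 𝕜 K x) {κ : ℝ} (hκ1 : 0 ≤ κ)
    (hκ : ∀ f g : X, ‖f + g‖ ≤ κ * (‖f‖ + ‖g‖)) (f : X) (s : Finset N) :
    ‖∑ n ∈ s, coeff 𝕜 x f n • x n‖ ≤ K * (κ * ‖f‖) := by
  classical
  have hK := hx.one_le
  refine le_of_forall_pos_le_add fun ε hε => ?_
  -- Only `0 ≤ κ` is known, so `κ + 1` keeps the denominator positive.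
  obtain ⟨t, ht⟩ := hasExpansion_iff.1 (hx.hasExpansion_coeff f) (ε / (K * (κ + 1)))
    (by positivity)
  have h₁ := (ht (t ∪ s) Finset.subset_union_left).le
  calc _ ≤ K * ‖∑ n ∈ t ∪ s, coeff 𝕜 x f n • x n‖ :=
        hx.norm_sum_subset_le Finset.subset_union_right _
    _ ≤ K * (κ * (‖f - ∑ n ∈ t ∪ s, coeff 𝕜 x f n • x n‖ + ‖f‖)) := by
        gcongr
        exact (IsQuasiNormed.norm_le_of_approx 𝕜 hκ f _).2
    _ ≤ K * (κ * (ε / (K * (κ + 1)) + ‖f‖)) := by gcongr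
    _ = K * (κ * ‖f‖) + ε * (κ / (κ + 1)) := by field_simp; ring
    _ ≤ K * (κ * ‖f‖) + ε * 1 := by
        gcongr
        rw [div_le_one (by positivity)]
        linarith
    _ = _ := by rw [mul_one]

end IsUnconditionalBasis

/-- The finite form of strong absoluteness. -/
theorem IsStronglyAbsolute.sum_norm_le [IsQuasiNormed 𝕜 X] {N : Type*} {x : N → X} {K : ℝ}
    {α : ℝ → ℝ} (hα : IsStronglyAbsolute 𝕜 α x) (hx : IsUnconditionalBasis 𝕜 K x)
    (hn : IsNormalizedFamily x) {R : ℝ} (hR : 0 < R) (s : Finset N) (a : N → 𝕜) {D : ℝ}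
    (hD0 : 0 ≤ D) (hD : ∀ n ∈ s, ‖a n‖ ≤ D) :
    ∑ n ∈ s, ‖a n‖ ≤ max (α R * D) (‖∑ n ∈ s, a n • x n‖ / R) := by
  classical
  obtain ⟨hpos, h⟩ := hα R hR
  specialize h (∑ n ∈ s, a n • x n)
  simp only [hx.coeff_sum, hn _, mul_one] at h
  have h₁ := (ENNReal.sum_le_tsum s).trans h
  rw [Finset.sum_congr rfl fun n hn => by rw [if_pos hn],
    ← ENNReal.ofReal_sum_of_nonneg fun _ _ => norm_nonneg _] at h₁
  have h₂ : ⨆ n, ENNReal.ofReal ‖if n ∈ s then a n else 0‖ ≤ ENNReal.ofReal D := by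
    refine iSup_le fun n => ENNReal.ofReal_le_ofReal ?_
    split_ifs with hn
    · exact hD n hn
    · simpa using hD0
  have h₃ := h₁.trans (max_le_max_right _ (mul_le_mul_right h₂ _))
  rw [← ENNReal.ofReal_mul hpos.le] at h₃
  have h₄ : 0 ≤ α R * D := mul_nonneg hpos.le hD0
  rcases le_max_iff.1 h₃ with h₃ | h₃
  · exact le_max_of_le_left ((ENNReal.ofReal_le_ofReal_iff h₄).1 h₃)
  · exact le_max_of_le_right ((ENNReal.ofReal_le_ofReal_iff
      (div_nonneg (IsQuasiNormed.norm_nonneg' 𝕜 _) hR.le)).1 h₃)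

end Expansions

/-! ### Extending equivalence from finite sums to closed spans. -/

section Equivalence

variable {𝕜 : Type*} {X Y M : Type*} [RCLike 𝕜] [AddCommGroup X] [Module 𝕜 X] [Norm X]
  [AddCommGroup Y] [Module 𝕜 Y] [Norm Y]

/-- `(f, t)` is in the closure of the linear relation generated by the pairs `(u m, v m)`. -/
def IsLimitPair (u : M → X) (v : M → Y) (𝕜 : Type*) [RCLike 𝕜] [Module 𝕜 X] [Module 𝕜 Y]
    (f : X) (t : Y) : Prop :=
  ∀ ε > 0, ∃ c : M →₀ 𝕜, ‖f - Finsupp.linearCombination 𝕜 u c‖ < ε ∧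
    ‖t - Finsupp.linearCombination 𝕜 v c‖ < ε

theorem IsLimitPair.symm {u : M → X} {v : M → Y} {f : X} {t : Y} (h : IsLimitPair u v 𝕜 f t) :
    IsLimitPair v u 𝕜 t f := fun ε hε => by
  obtain ⟨c, h₁, h₂⟩ := h ε hε
  exact ⟨c, h₂, h₁⟩

variable [IsQuasiNormed 𝕜 X] [IsQuasiNormed 𝕜 Y]

theorem IsLimitPair.add {u : M → X} {v : M → Y} {f f' : X} {t t' : Y}
    (h : IsLimitPair u v 𝕜 f t) (h' : IsLimitPair u v 𝕜 f' t') :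
    IsLimitPair u v 𝕜 (f + f') (t + t') := by
  intro ε hε
  obtain ⟨κ₁, hκ₁, hc₁⟩ := IsQuasiNormed.exists_concavity (𝕜 := 𝕜) (X := X)
  obtain ⟨κ₂, hκ₂, hc₂⟩ := IsQuasiNormed.exists_concavity (𝕜 := 𝕜) (X := Y)
  have h₁ : 0 < κ₁ := by linarith
  have h₂ : 0 < κ₂ := by linarith
  obtain ⟨c, ha, hb⟩ := h (min (ε / (2 * κ₁)) (ε / (2 * κ₂))) (by positivity)
  obtain ⟨c', ha', hb'⟩ := h' (min (ε / (2 * κ₁)) (ε / (2 * κ₂))) (by positivity)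
  refine ⟨c + c', ?_, ?_⟩
  · rw [map_add, add_sub_add_comm]
    calc _ ≤ κ₁ * (_ + _) := hc₁ _ _
      _ < κ₁ * (ε / (2 * κ₁) + ε / (2 * κ₁)) := by
        gcongr
        · exact ha.trans_le (min_le_left _ _)
        · exact ha'.trans_le (min_le_left _ _)
      _ = ε := by field_simp; ring
  · rw [map_add, add_sub_add_comm]
    calc _ ≤ κ₂ * (_ + _) := hc₂ _ _
      _ < κ₂ * (ε / (2 * κ₂) + ε / (2 * κ₂)) := by
        gcongr
        · exact hb.trans_le (min_le_right _ _)
        · exact hb'.trans_le (min_le_right _ _)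
      _ = ε := by field_simp; ring

theorem IsLimitPair.smul {u : M → X} {v : M → Y} {f : X} {t : Y}
    (h : IsLimitPair u v 𝕜 f t) (r : 𝕜) : IsLimitPair u v 𝕜 (r • f) (r • t) := by
  intro ε hε
  obtain ⟨c, h₁, h₂⟩ := h (ε / (‖r‖ + 1)) (by positivity)
  have key : ∀ z : ℝ, 0 ≤ z → z < ε / (‖r‖ + 1) → ‖r‖ * z < ε := fun z hz0 hz => by
    rw [lt_div_iff₀ (by positivity)] at hz
    nlinarith
  refine ⟨r • c, ?_, ?_⟩
  · rw [map_smul, ← smul_sub, IsQuasiNormed.norm_smul]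
    exact key _ (IsQuasiNormed.norm_nonneg' 𝕜 _) h₁
  · rw [map_smul, ← smul_sub, IsQuasiNormed.norm_smul]
    exact key _ (IsQuasiNormed.norm_nonneg' 𝕜 _) h₂

/-- One factor `κ` is lost in approximating `t` and one in approximating `f`; then `ε → 0`. Applied
to a difference of two pairs, this makes the closed relation single-valued; applied to the pair and
its flip, it bounds the map and its inverse. -/
theorem IsLimitPair.norm_le {u : M → X} {v : M → Y} {κ C : ℝ} (hκ0 : 0 ≤ κ) (hC : 0 ≤ C)
    (hX : ∀ f g : X, ‖f + g‖ ≤ κ * (‖f‖ + ‖g‖)) (hY : ∀ f g : Y, ‖f + g‖ ≤ κ * (‖f‖ + ‖g‖))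
    (huv : ∀ c : M →₀ 𝕜,
      ‖Finsupp.linearCombination 𝕜 v c‖ ≤ C * ‖Finsupp.linearCombination 𝕜 u c‖)
    {f : X} {t : Y} (h : IsLimitPair u v 𝕜 f t) : ‖t‖ ≤ κ ^ 2 * C * ‖f‖ := by
  have hlim : Tendsto (fun ε : ℝ => κ * (ε + C * (κ * (ε + ‖f‖)))) (𝓝[>] 0)
      (𝓝 (κ * (0 + C * (κ * (0 + ‖f‖))))) :=
    (Continuous.tendsto (by fun_prop) 0).mono_left nhdsWithin_le_nhds
  refine (ge_of_tendsto hlim ?_).trans_eq (by ring)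
  filter_upwards [self_mem_nhdsWithin] with ε hε
  obtain ⟨c, h₁, h₂⟩ := h ε hε
  calc ‖t‖ ≤ κ * (‖t - Finsupp.linearCombination 𝕜 v c‖ + ‖Finsupp.linearCombination 𝕜 v c‖) :=
        (IsQuasiNormed.norm_le_of_approx 𝕜 hY _ _).1
    _ ≤ κ * (ε + C * (κ * (ε + ‖f‖))) := by
        gcongr
        refine (huv c).trans ?_
        gcongr
        refine (IsQuasiNormed.norm_le_of_approx 𝕜 hX f _).2.trans ?_
        gcongr

/-- Combinations of the `u m` approximating `f` form a Cauchy sequence, and domination transfers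
this to the same combinations of the `v m`; completeness of `Y` gives the limit. -/
theorem IsLimitPair.exists_of_mem_closedSpan {𝕜 : Type*} {X Y M : Type*} [RCLike 𝕜]
    [AddCommGroup X] [Module 𝕜 X] [Norm X] [AddCommGroup Y] [Module 𝕜 Y] [Norm Y]
    [IsQuasiNormed 𝕜 X] [IsQuasiBanach 𝕜 Y] {u : M → X} {v : M → Y} {C : ℝ} (hC : 0 < C)
    (huv : ∀ c : M →₀ 𝕜,
      ‖Finsupp.linearCombination 𝕜 v c‖ ≤ C * ‖Finsupp.linearCombination 𝕜 u c‖)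
    {f : X} (hf : f ∈ closedSpan 𝕜 u) : ∃ t, IsLimitPair u v 𝕜 f t := by
  obtain ⟨κ, hκ, hc⟩ := IsQuasiNormed.exists_concavity (𝕜 := 𝕜) (X := X)
  have hκ0 : 0 < κ := by linarith
  have h : ∀ k : ℕ, ∃ c : M →₀ 𝕜, ‖f - Finsupp.linearCombination 𝕜 u c‖ < 1 / ((k : ℝ) + 1) := by
    intro k
    obtain ⟨g, hg, h⟩ := hf (1 / ((k : ℝ) + 1)) (by positivity)
    obtain ⟨c, rfl⟩ := Finsupp.mem_span_range_iff_exists_finsupp.1 hg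
    exact ⟨c, h⟩
  choose c hc' using h
  have hsmall : ∀ ε > 0, ∃ k : ℕ, ∀ m ≥ k, 1 / ((m : ℝ) + 1) < ε := fun ε hε => by
    obtain ⟨k, hk⟩ := exists_nat_one_div_lt hε
    exact ⟨k, fun m hm => (one_div_le_one_div_of_le (by positivity) (by gcongr)).trans_lt hk⟩
  obtain ⟨t, ht⟩ := IsQuasiBanach.complete (𝕜 := 𝕜)
    (fun k => Finsupp.linearCombination 𝕜 v (c k)) (by
      intro ε hε
      obtain ⟨k, hk⟩ := hsmall (ε / (2 * (C * κ))) (by positivity)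
      refine ⟨k, fun m hm n hn => ?_⟩
      rw [← map_sub]
      calc _ ≤ C * _ := huv _
        _ = C * ‖(f - Finsupp.linearCombination 𝕜 u (c n)) -
              (f - Finsupp.linearCombination 𝕜 u (c m))‖ := by
            rw [map_sub, sub_sub_sub_cancel_left]
        _ ≤ C * (κ * (_ + _)) := by
            gcongr
            exact IsQuasiNormed.norm_sub_le_of_concavity 𝕜 hc _ _
        _ < C * (κ * (ε / (2 * (C * κ)) + ε / (2 * (C * κ)))) := by
            gcongr
            · exact (hc' n).trans (hk n hn)
            · exact (hc' m).trans (hk m hm)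
        _ = ε := by field_simp; ring)
  refine ⟨t, fun ε hε => ?_⟩
  obtain ⟨k, hk⟩ := hsmall ε hε
  obtain ⟨l, hl⟩ := (Metric.tendsto_atTop.1 ht) ε hε
  refine ⟨c (max k l), (hc' _).trans (hk _ (le_max_left _ _)), ?_⟩
  rw [IsQuasiNormed.norm_sub_comm 𝕜]
  have := hl (max k l) (le_max_right _ _)
  rw [Real.dist_eq, sub_zero] at this
  exact (le_abs_self _).trans_lt this

/-- Equivalence of families may be tested on finite sums. -/
theorem areEquivalent_of_finite_sums {𝕜 : Type*} {X Y M : Type*} [RCLike 𝕜]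
    [AddCommGroup X] [Module 𝕜 X] [Norm X] [AddCommGroup Y] [Module 𝕜 Y] [Norm Y]
    [IsQuasiNormed 𝕜 X] [IsQuasiBanach 𝕜 Y] {u : M → X} {v : M → Y} {κ C : ℝ} (hκ : 1 ≤ κ)
    (hC : 1 ≤ C)
    (hX : ∀ f g : X, ‖f + g‖ ≤ κ * (‖f‖ + ‖g‖)) (hY : ∀ f g : Y, ‖f + g‖ ≤ κ * (‖f‖ + ‖g‖))
    (huv : ∀ (F : Finset M) (c : M → 𝕜),
      ‖∑ m ∈ F, c m • v m‖ ≤ C * ‖∑ m ∈ F, c m • u m‖ ∧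
      ‖∑ m ∈ F, c m • u m‖ ≤ C * ‖∑ m ∈ F, c m • v m‖) :
    AreEquivalent 𝕜 (κ ^ 2 * C) u v := by
  have hκ0 : 0 ≤ κ := by linarith
  have hC0 : 0 < C := by linarith
  have huv₁ : ∀ c : M →₀ 𝕜,
      ‖Finsupp.linearCombination 𝕜 v c‖ ≤ C * ‖Finsupp.linearCombination 𝕜 u c‖ :=
    fun c => (huv c.support c).1
  have huv₂ : ∀ c : M →₀ 𝕜,
      ‖Finsupp.linearCombination 𝕜 u c‖ ≤ C * ‖Finsupp.linearCombination 𝕜 v c‖ :=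
    fun c => (huv c.support c).2
  have huniq : ∀ {f : X} {t t' : Y}, IsLimitPair u v 𝕜 f t → IsLimitPair u v 𝕜 f t' → t = t' := by
    intro f t t' h h'
    have h₀ := (h.add (h'.smul (-1))).norm_le hκ0 hC0.le hX hY huv₁
    rw [neg_one_smul, neg_one_smul, add_neg_cancel, IsQuasiNormed.norm_zero_eq 𝕜, mul_zero,
      ← sub_eq_add_neg] at h₀
    exact sub_eq_zero.1 (IsQuasiNormed.eq_zero_of_norm_le_zero 𝕜 h₀)
  have hex : ∀ f : closedSpan 𝕜 u, ∃ t, IsLimitPair u v 𝕜 (f : X) t := fun f =>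
    IsLimitPair.exists_of_mem_closedSpan hC0 huv₁ f.2
  choose T hT using hex
  refine ⟨by nlinarith [one_le_pow₀ hκ (n := 2)],
    { toFun := T
      map_add' := fun f g => huniq (hT _) ((hT f).add (hT g))
      map_smul' := fun r f => huniq (hT _) ((hT f).smul r) }, fun m hm => ?_, fun f => ⟨?_, ?_⟩⟩
  · refine huniq (hT _) fun ε hε => ⟨Finsupp.single m 1, ?_, ?_⟩
    · simpa [IsQuasiNormed.norm_zero_eq 𝕜] using hε
    · simpa [IsQuasiNormed.norm_zero_eq 𝕜] using hε
  · exact (hT f).norm_le hκ0 hC0.le hX hY huv₁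
  · exact (hT f).symm.norm_le hκ0 hC0.le hY hX huv₂

end Equivalence

/-! ### The `ℓ₁`-sum: completeness, its basis and its `ℓ₁`-estimates. -/

section L1Sum

variable {𝕜 : Type*} {J : Type*} {X : J → Type*} [RCLike 𝕜] [∀ j, AddCommGroup (X j)]
  [∀ j, Module 𝕜 (X j)] [∀ j, Norm (X j)] {κ : ℝ}

section Norms

variable [∀ j, IsQuasiNormed 𝕜 (X j)]

theorem l1Sum_norm_def {hκ : ∀ j, modulusOfConcavity (X j) ≤ κ} (f : l1Sum 𝕜 X κ hκ) :
    ‖f‖ = ∑' j, ‖f.1 j‖ := rfl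

theorem l1Sum_coord_le {hκ : ∀ j, modulusOfConcavity (X j) ≤ κ} (f : l1Sum 𝕜 X κ hκ) (j : J) :
    ‖f.1 j‖ ≤ ‖f‖ :=
  f.2.le_tsum j fun _ _ => IsQuasiNormed.norm_nonneg' 𝕜 _

theorem l1Sum_sum_coord_le {hκ : ∀ j, modulusOfConcavity (X j) ≤ κ} (f : l1Sum 𝕜 X κ hκ)
    (s : Finset J) : ∑ j ∈ s, ‖f.1 j‖ ≤ ‖f‖ :=
  f.2.sum_le_tsum s fun _ _ => IsQuasiNormed.norm_nonneg' 𝕜 _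

/-- Restricting to a finite set of coordinates allows `m → ∞` in `‖u n - u m‖ < ε`. The bound is
independent of the set, hence gives both that the limit lies in the sum and that the convergence is
in norm. -/
theorem l1Sum_sum_norm_sub_le {hκ : ∀ j, modulusOfConcavity (X j) ≤ κ} {κ' : ℝ} (hκ' : 0 < κ')
    (hκκ' : κ ≤ κ') (u : ℕ → l1Sum 𝕜 X κ hκ) (g : ∀ j, X j)
    (hg : ∀ j, Tendsto (fun n => ‖(u n).1 j - g j‖) atTop (𝓝 0)) {ε : ℝ} {k : ℕ}
    (hk : ∀ m ≥ k, ∀ n ≥ k, ‖u m - u n‖ < ε) {n : ℕ} (hn : n ≥ k) (s : Finset J) :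
    ∑ j ∈ s, ‖(u n).1 j - g j‖ ≤ κ' * ε := by
  have ht : Tendsto (fun m => κ' * (ε + ∑ j ∈ s, ‖(u m).1 j - g j‖)) atTop
      (𝓝 (κ' * (ε + ∑ j ∈ s, 0))) :=
    ((tendsto_finsetSum s fun j _ => hg j).const_add ε).const_mul κ'
  rw [Finset.sum_const_zero, add_zero] at ht
  refine ge_of_tendsto ht ?_
  filter_upwards [eventually_ge_atTop k] with m hm
  have h₁ : ∑ j ∈ s, ‖(u n).1 j - (u m).1 j‖ ≤ ε :=
    (l1Sum_sum_coord_le (u n - u m) s).trans (hk n hn m hm).le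
  calc ∑ j ∈ s, ‖(u n).1 j - g j‖
      ≤ ∑ j ∈ s, κ' * (‖(u n).1 j - (u m).1 j‖ + ‖(u m).1 j - g j‖) := by
        refine Finset.sum_le_sum fun j _ => ?_
        have := IsQuasiNormed.norm_add_le_of_modulus_le 𝕜 ((hκ j).trans hκκ')
          ((u n).1 j - (u m).1 j) ((u m).1 j - g j)
        rwa [sub_add_sub_cancel] at this
    _ = κ' * (∑ j ∈ s, ‖(u n).1 j - (u m).1 j‖ + ∑ j ∈ s, ‖(u m).1 j - g j‖) := by
        rw [← Finset.mul_sum, Finset.sum_add_distrib]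
    _ ≤ κ' * (ε + ∑ j ∈ s, ‖(u m).1 j - g j‖) := by gcongr

/-- A Cauchy sequence in the `ℓ₁`-sum converges to its coordinatewise limit. -/
theorem l1Sum_exists_tendsto {hκ : ∀ j, modulusOfConcavity (X j) ≤ κ} (u : ℕ → l1Sum 𝕜 X κ hκ)
    (hu : ∀ ε > 0, ∃ k, ∀ m ≥ k, ∀ n ≥ k, ‖u m - u n‖ < ε) (g : ∀ j, X j)
    (hg : ∀ j, Tendsto (fun n => ‖(u n).1 j - g j‖) atTop (𝓝 0)) :
    ∃ f : l1Sum 𝕜 X κ hκ, Tendsto (fun n => ‖u n - f‖) atTop (𝓝 0) := by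
  obtain ⟨κ', hκ', hκκ'⟩ : ∃ κ' : ℝ, 0 < κ' ∧ κ ≤ κ' :=
    ⟨max κ 1, lt_of_lt_of_le one_pos (le_max_right _ _), le_max_left _ _⟩
  have hg1 : g ∈ l1Sum 𝕜 X κ hκ := by
    obtain ⟨k, hk⟩ := hu 1 one_pos
    have h₀ : (u k).1 - g ∈ l1Sum 𝕜 X κ hκ :=
      summable_of_sum_le (fun j => IsQuasiNormed.norm_nonneg' 𝕜 _)
        (l1Sum_sum_norm_sub_le hκ' hκκ' u g hg hk le_rfl)
    have h := Submodule.sub_mem _ (u k).2 h₀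
    rwa [sub_sub_cancel] at h
  refine ⟨⟨g, hg1⟩, ?_⟩
  rw [Metric.tendsto_atTop]
  intro ε hε
  obtain ⟨k, hk⟩ := hu (ε / (2 * κ')) (by positivity)
  refine ⟨k, fun n hn => ?_⟩
  rw [Real.dist_eq, sub_zero, abs_of_nonneg (IsQuasiNormed.norm_nonneg' 𝕜 _)]
  have h₁ : ‖u n - ⟨g, hg1⟩‖ ≤ κ' * (ε / (2 * κ')) :=
    (u n - ⟨g, hg1⟩).2.tsum_le_of_sum_le fun s => l1Sum_sum_norm_sub_le hκ' hκκ' u g hg hk hn s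
  have h₂ : κ' * (ε / (2 * κ')) = ε / 2 := by field_simp
  linarith

theorem l1Embed_norm (hκ : ∀ j, modulusOfConcavity (X j) ≤ κ) (j : J) (v : X j) :
    ‖l1Embed 𝕜 hκ j v‖ = ‖v‖ := by
  classical
  rw [l1Sum_norm_def, tsum_eq_single j]
  · change ‖Pi.single j v j‖ = _
    convert rfl
    rw [Pi.single_eq_same]
  · intro i hi
    change ‖Pi.single j v i‖ = _
    rw [Pi.single_eq_of_ne hi, IsQuasiNormed.norm_zero_eq 𝕜]

variable {N : J → Type*}

/-- The coordinate in `X j` of a finite sum along the basis of the `ℓ₁`-sum. -/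
theorem l1SumBasis_sum_coord (hκ : ∀ j, modulusOfConcavity (X j) ≤ κ) (x : ∀ j, N j → X j)
    (A : Finset (Σ j, N j)) (a : (Σ j, N j) → 𝕜) (j : J) :
    (∑ p ∈ A, a p • l1SumBasis 𝕜 hκ x p).1 j =
      ∑ n ∈ A.preimage (Sigma.mk j) sigma_mk_injective.injOn, a ⟨j, n⟩ • x j n := by
  classical
  have h : ∀ p : Σ j, N j, (a p • l1SumBasis 𝕜 hκ x p).1 j =
      a p • (Pi.single p.1 (x p.1 p.2) : ∀ j, X j) j := fun p => by
    change a p • (Pi.single p.1 (x p.1 p.2) : ∀ j, X j) j = _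
    congr!
  rw [AddSubmonoidClass.coe_finsetSum, Finset.sum_apply]
  simp only [h]
  rw [← Finset.sum_preimage (Sigma.mk j) A sigma_mk_injective.injOn]
  · simp
  · rintro ⟨i, n⟩ _ hp
    have : j ≠ i := by
      rintro rfl
      exact hp ⟨n, rfl⟩
    rw [Pi.single_eq_of_ne this, smul_zero]

theorem l1SumBasis_isNormalized (hκ : ∀ j, modulusOfConcavity (X j) ≤ κ) {x : ∀ j, N j → X j}
    (hn : ∀ j, IsNormalizedFamily (x j)) : IsNormalizedFamily (l1SumBasis 𝕜 hκ x) := fun p => by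
  rw [l1SumBasis, l1Embed_norm, hn]

/-- A dominated convergence argument: the error in coordinate `j` is at most `D * ‖f.1 j‖` whatever
the partial sum, so a finite set of coordinates carries all but `ε / 4` of it, and there the
coordinate expansions converge. -/
theorem l1SumBasis_hasExpansion (hκ : ∀ j, modulusOfConcavity (X j) ≤ κ) {K : ℝ}
    {x : ∀ j, N j → X j} (hx : ∀ j, IsUnconditionalBasis 𝕜 K (x j)) (f : l1Sum 𝕜 X κ hκ) :
    HasExpansion (l1SumBasis 𝕜 hκ x) (fun p => coeff 𝕜 (x p.1) (f.1 p.1) p.2) f := by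
  classical
  set κ' := max κ 1
  -- For empty `J` the hypotheses put no lower bound on `κ`, whence the maximum with `1`.
  have hκ' : 0 < κ' := lt_of_lt_of_le one_pos (le_max_right _ _)
  have hc : ∀ j (f g : X j), ‖f + g‖ ≤ κ' * (‖f‖ + ‖g‖) := fun j =>
    IsQuasiNormed.norm_add_le_of_modulus_le 𝕜 ((hκ j).trans (le_max_left κ 1))
  set D := κ' * (1 + |K| * κ')
  have hD0 : 0 < D := by positivity
  have hD : ∀ j (s : Finset (N j)),
      ‖f.1 j - ∑ n ∈ s, coeff 𝕜 (x j) (f.1 j) n • x j n‖ ≤ D * ‖f.1 j‖ := fun j s => by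
    have h₀ : 0 ≤ ‖f.1 j‖ := IsQuasiNormed.norm_nonneg' 𝕜 _
    calc _ ≤ κ' * (‖f.1 j‖ + ‖∑ n ∈ s, coeff 𝕜 (x j) (f.1 j) n • x j n‖) :=
          IsQuasiNormed.norm_sub_le_of_concavity 𝕜 (hc j) _ _
      _ ≤ κ' * (‖f.1 j‖ + |K| * (κ' * ‖f.1 j‖)) := by
          gcongr
          refine ((hx j).norm_partialSum_le hκ'.le (hc j) _ s).trans ?_
          gcongr
          exact le_abs_self K
      _ = D * ‖f.1 j‖ := by ring
  rw [hasExpansion_iff]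
  intro ε hε
  obtain ⟨s, hs⟩ : ∃ s : Finset J, ∀ t, Disjoint t s → ∑ j ∈ t, ‖f.1 j‖ < ε / (4 * D) := by
    obtain ⟨s, hs⟩ := summable_iff_vanishing_norm.1 f.2 (ε / (4 * D)) (by positivity)
    exact ⟨s, fun t ht => (le_abs_self _).trans_lt (hs t ht)⟩
  have hcoord : ∀ j, ∃ t₀ : Finset (N j), ∀ t, t₀ ⊆ t →
      ‖f.1 j - ∑ n ∈ t, coeff 𝕜 (x j) (f.1 j) n • x j n‖ < ε / (4 * (s.card + 1)) := fun j =>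
    hasExpansion_iff.1 ((hx j).hasExpansion_coeff (f.1 j)) _ (by positivity)
  choose t₀ ht₀ using hcoord
  refine ⟨s.sigma t₀, fun A hA => ?_⟩
  set g := f - ∑ p ∈ A, coeff 𝕜 (x p.1) (f.1 p.1) p.2 • l1SumBasis 𝕜 hκ x p with hg
  have hgj : ∀ j, g.1 j = f.1 j -
      ∑ n ∈ A.preimage (Sigma.mk j) sigma_mk_injective.injOn,
        coeff 𝕜 (x j) (f.1 j) n • x j n := fun j => by
    rw [hg, AddSubgroupClass.coe_sub, Pi.sub_apply,
      l1SumBasis_sum_coord hκ x A (fun p => coeff 𝕜 (x p.1) (f.1 p.1) p.2)]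
  have hbound : ‖g‖ ≤ ε / 4 + ε / 4 := by
    refine Summable.tsum_le_of_sum_le g.2 fun u => ?_
    rw [← Finset.sum_inter_add_sum_sdiff u s]
    refine add_le_add ?_ ?_
    · calc ∑ j ∈ u ∩ s, ‖g.1 j‖ ≤ ∑ j ∈ s, ‖g.1 j‖ :=
            Finset.sum_le_sum_of_subset_of_nonneg Finset.inter_subset_right
              fun j _ _ => IsQuasiNormed.norm_nonneg' 𝕜 _
        _ ≤ ∑ j ∈ s, ε / (4 * (s.card + 1)) := by
            refine Finset.sum_le_sum fun j hj => ?_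
            rw [hgj]
            refine (ht₀ j _ fun n hn => ?_).le
            rw [Finset.mem_preimage]
            exact hA (Finset.mem_sigma.2 ⟨hj, hn⟩)
        _ = ε / 4 * (s.card / (s.card + 1)) := by
            rw [Finset.sum_const, nsmul_eq_mul]
            field_simp
        _ ≤ ε / 4 * 1 := by
            gcongr
            rw [div_le_one (by positivity)]
            linarith
        _ = ε / 4 := mul_one _
    · calc ∑ j ∈ u \ s, ‖g.1 j‖ ≤ ∑ j ∈ u \ s, D * ‖f.1 j‖ := by
            refine Finset.sum_le_sum fun j _ => ?_
            rw [hgj]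
            exact hD j _
        _ ≤ D * (ε / (4 * D)) := by
            rw [← Finset.mul_sum]
            gcongr
            exact (hs _ Finset.sdiff_disjoint).le
        _ = ε / 4 := by field_simp
  linarith

theorem HasExpansion.l1Sum_coord {hκ : ∀ j, modulusOfConcavity (X j) ≤ κ}
    {x : ∀ j, N j → X j} {f : l1Sum 𝕜 X κ hκ} {a : (Σ j, N j) → 𝕜}
    (h : HasExpansion (l1SumBasis 𝕜 hκ x) a f) (j : J) :
    HasExpansion (x j) (fun n => a ⟨j, n⟩) (f.1 j) := by
  classical
  rw [hasExpansion_iff] at h ⊢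
  intro ε hε
  obtain ⟨A₀, hA₀⟩ := h ε hε
  refine ⟨A₀.preimage (Sigma.mk j) sigma_mk_injective.injOn, fun t ht => ?_⟩
  -- Adjoining `t` in colour `j` to `A₀` gives a set that is large enough and has fibre exactly `t`
  -- over `j`.
  have hpre : (A₀ ∪ t.map ⟨Sigma.mk j, sigma_mk_injective⟩).preimage (Sigma.mk j)
      sigma_mk_injective.injOn = t := by
    ext n
    simp only [Finset.mem_preimage, Finset.mem_union, Finset.mem_map, Function.Embedding.coeFn_mk]
    constructor
    · rintro (hn | ⟨m, hm, hmn⟩)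
      · exact ht (Finset.mem_preimage.2 hn)
      · rwa [← sigma_mk_injective hmn]
    · exact fun hn => Or.inr ⟨n, hn, rfl⟩
  have h₁ := (l1Sum_coord_le _ j).trans_lt
    (hA₀ (A₀ ∪ t.map ⟨Sigma.mk j, sigma_mk_injective⟩) Finset.subset_union_left)
  rw [AddSubgroupClass.coe_sub, Pi.sub_apply, l1SumBasis_sum_coord] at h₁
  rwa [hpre] at h₁

theorem l1SumBasis_isUnconditionalBasis (hκ : ∀ j, modulusOfConcavity (X j) ≤ κ) {K : ℝ}
    (hK : 1 ≤ K) {x : ∀ j, N j → X j} (hx : ∀ j, IsUnconditionalBasis 𝕜 K (x j)) :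
    IsUnconditionalBasis 𝕜 K (l1SumBasis 𝕜 hκ x) where
  basicSeq := fun f _ => by
    refine ⟨_, l1SumBasis_hasExpansion hκ hx f, fun a ha => ?_⟩
    ext ⟨j, n⟩
    exact (congrFun ((hx j).coeff_eq (ha.l1Sum_coord j)) n).symm
  closedSpan_eq_top := eq_top_iff.2 fun f _ =>
    mem_closedSpan_of_hasExpansion (l1SumBasis_hasExpansion hκ hx f)
  one_le := hK
  norm_sum_le := by
    intro s a b hab
    rw [l1Sum_norm_def, l1Sum_norm_def, ← tsum_mul_left]
    refine Summable.tsum_le_tsum (fun j => ?_) (∑ n ∈ s, a n • l1SumBasis 𝕜 hκ x n).2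
      (Summable.mul_left _ (∑ n ∈ s, b n • l1SumBasis 𝕜 hκ x n).2)
    rw [l1SumBasis_sum_coord, l1SumBasis_sum_coord]
    exact (hx j).norm_sum_le _ _ _ fun n hn => hab _ (Finset.mem_preimage.1 hn)

theorem sum_sigma_eq_sum_preimage [DecidableEq J] {β : Type*} [AddCommMonoid β]
    (A : Finset (Σ j, N j)) (F : (Σ j, N j) → β) :
    ∑ p ∈ A, F p = ∑ j ∈ A.image Sigma.fst,
      ∑ n ∈ A.preimage (Sigma.mk j) sigma_mk_injective.injOn, F ⟨j, n⟩ := by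
  rw [← Finset.sum_sigma (A.image Sigma.fst)
    (fun j => A.preimage (Sigma.mk j) sigma_mk_injective.injOn) F,
    Finset.sigma_image_fst_preimage_mk]

theorem l1SumBasis_norm_sum [DecidableEq J] (hκ : ∀ j, modulusOfConcavity (X j) ≤ κ)
    (x : ∀ j, N j → X j) (A : Finset (Σ j, N j)) (a : (Σ j, N j) → 𝕜) :
    ‖∑ p ∈ A, a p • l1SumBasis 𝕜 hκ x p‖ = ∑ j ∈ A.image Sigma.fst,
      ‖∑ n ∈ A.preimage (Sigma.mk j) sigma_mk_injective.injOn, a ⟨j, n⟩ • x j n‖ := by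
  rw [l1Sum_norm_def, tsum_eq_sum (s := A.image Sigma.fst)]
  · simp only [l1SumBasis_sum_coord]
  · intro j hj
    rw [l1SumBasis_sum_coord, Finset.sum_eq_zero, IsQuasiNormed.norm_zero_eq 𝕜]
    intro n hn
    exact absurd (Finset.mem_image_of_mem Sigma.fst (Finset.mem_preimage.1 hn)) hj

/-- Basis vectors from distinct summands satisfy an upper `ℓ₁`-estimate. -/
theorem l1SumBasis_norm_sum_le (hκ : ∀ j, modulusOfConcavity (X j) ≤ κ)
    {x : ∀ j, N j → X j} (hn : ∀ j, IsNormalizedFamily (x j)) (A : Finset (Σ j, N j))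
    (hA : Set.InjOn Sigma.fst (A : Set (Σ j, N j))) (a : (Σ j, N j) → 𝕜) :
    ‖∑ p ∈ A, a p • l1SumBasis 𝕜 hκ x p‖ ≤ ∑ p ∈ A, ‖a p‖ := by
  classical
  rw [l1SumBasis_norm_sum, Finset.sum_image hA]
  refine Finset.sum_le_sum fun p hp => ?_
  obtain ⟨j, n⟩ := p
  have : A.preimage (Sigma.mk j) sigma_mk_injective.injOn = {n} := by
    ext m
    rw [Finset.mem_preimage, Finset.mem_singleton]
    constructor
    · exact fun hm => sigma_mk_injective (hA hm hp rfl)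
    · rintro rfl
      exact hp
  simp only [this, Finset.sum_singleton, IsQuasiNormed.norm_smul, hn j n, mul_one, le_refl]

/-- The maximum in strong absoluteness is weakened to a sum, which adds up over the coordinates
because the norm is an `ℓ₁`-sum. The supremum is allowed a separate bound `D j` in each coordinate.
-/
theorem l1SumBasis_sum_norm_le_add [DecidableEq J] (hκ : ∀ j, modulusOfConcavity (X j) ≤ κ)
    {K : ℝ} {x : ∀ j, N j → X j} (hx : ∀ j, IsUnconditionalBasis 𝕜 K (x j))
    (hn : ∀ j, IsNormalizedFamily (x j)) {α : ℝ → ℝ} (hα : ∀ j, IsStronglyAbsolute 𝕜 α (x j))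
    {R : ℝ} (hR : 0 < R) (A : Finset (Σ j, N j)) (a : (Σ j, N j) → 𝕜) (D : J → ℝ)
    (hD0 : ∀ j, 0 ≤ D j) (hD : ∀ p ∈ A, ‖a p‖ ≤ D p.1) :
    ∑ p ∈ A, ‖a p‖ ≤ α R * ∑ j ∈ A.image Sigma.fst, D j +
      ‖∑ p ∈ A, a p • l1SumBasis 𝕜 hκ x p‖ / R := by
  rw [l1SumBasis_norm_sum, sum_sigma_eq_sum_preimage, Finset.mul_sum, Finset.sum_div,
    ← Finset.sum_add_distrib]
  refine Finset.sum_le_sum fun j _ => ?_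
  refine ((hα j).sum_norm_le (hx j) (hn j) hR _ _ (hD0 j)
    fun n hn => hD _ (Finset.mem_preimage.1 hn)).trans ?_
  exact max_le_add_of_nonneg (mul_nonneg (hα j R hR).1.le (hD0 j))
    (div_nonneg (IsQuasiNormed.norm_nonneg' 𝕜 _) hR.le)

/-- In each coordinate, strong absoluteness is used with `R = 1`; unconditionality bounds single
coefficients by `K` times the norm. -/
theorem l1SumBasis_sum_norm_le (hκ : ∀ j, modulusOfConcavity (X j) ≤ κ)
    {K : ℝ} {x : ∀ j, N j → X j} (hx : ∀ j, IsUnconditionalBasis 𝕜 K (x j))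
    (hn : ∀ j, IsNormalizedFamily (x j)) {α : ℝ → ℝ} (hα : ∀ j, IsStronglyAbsolute 𝕜 α (x j))
    (A : Finset (Σ j, N j)) (a : (Σ j, N j) → 𝕜) :
    ∑ p ∈ A, ‖a p‖ ≤ max (α 1 * K) 1 * ‖∑ p ∈ A, a p • l1SumBasis 𝕜 hκ x p‖ := by
  classical
  rw [l1SumBasis_norm_sum, sum_sigma_eq_sum_preimage, Finset.mul_sum]
  refine Finset.sum_le_sum fun j _ => ?_
  set s := A.preimage (Sigma.mk j) sigma_mk_injective.injOn
  set v := ∑ n ∈ s, a ⟨j, n⟩ • x j n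
  have hv : 0 ≤ ‖v‖ := IsQuasiNormed.norm_nonneg' 𝕜 _
  have hK := (hx j).one_le
  refine ((hα j).sum_norm_le (hx j) (hn j) one_pos s (fun n => a ⟨j, n⟩) (D := K * ‖v‖)
    (by positivity) fun n hns => ?_).trans ?_
  · have h := (hx j).norm_sum_subset_le (Finset.singleton_subset_iff.2 hns) fun n => a ⟨j, n⟩
    rwa [Finset.sum_singleton, IsQuasiNormed.norm_smul, hn j n, mul_one] at h
  · rw [max_mul_of_nonneg _ _ hv, div_one, one_mul, mul_assoc]

end Norms

theorem l1Sum_isQuasiBanach [∀ j, IsQuasiBanach 𝕜 (X j)]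
    (hκ : ∀ j, modulusOfConcavity (X j) ≤ κ) : IsQuasiBanach 𝕜 (l1Sum 𝕜 X κ hκ) where
  complete := by
    intro u hu
    have hlim : ∀ j, ∃ g : X j, Tendsto (fun n => ‖(u n).1 j - g‖) atTop (𝓝 0) := fun j =>
      IsQuasiBanach.complete (𝕜 := 𝕜) (fun n => (u n).1 j) fun ε hε => by
        obtain ⟨k, hk⟩ := hu ε hε
        exact ⟨k, fun m hm n hn => (l1Sum_coord_le (u m - u n) j).trans_lt (hk m hm n hn)⟩
    choose g hg using hlim
    exact l1Sum_exists_tendsto u hu g hg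

end L1Sum

/-! ### Maximal representatives of colours and a variant of Hall's theorem. -/

section Combinatorics

theorem Finset.exists_injOn_max {N J : Type*} (ρ : N → J) (w : N → ℝ) (s : Finset N) :
    ∃ t ⊆ s, Set.InjOn ρ (t : Set N) ∧ ∀ p ∈ s, ∃ q ∈ t, ρ q = ρ p ∧ w p ≤ w q := by
  classical
  have h : ∀ j ∈ s.image ρ, ∃ q ∈ s, ρ q = j ∧ ∀ p ∈ s, ρ p = j → w p ≤ w q := by
    intro j hj
    obtain ⟨p, hp, hpj⟩ := Finset.mem_image.1 hj
    obtain ⟨q, hq, hmax⟩ := (s.filter fun p => ρ p = j).exists_max_image w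
      ⟨p, Finset.mem_filter.2 ⟨hp, hpj⟩⟩
    rw [Finset.mem_filter] at hq
    exact ⟨q, hq.1, hq.2, fun p hp hpj => hmax p (Finset.mem_filter.2 ⟨hp, hpj⟩)⟩
  choose q hq hqj hmax using h
  refine ⟨(s.image ρ).attach.image fun j => q j.1 j.2, ?_, ?_, fun p hp => ?_⟩
  · intro n hn
    obtain ⟨j, _, rfl⟩ := Finset.mem_image.1 hn
    exact hq _ _
  · intro n hn n' hn' hnn'
    obtain ⟨j, _, rfl⟩ := Finset.mem_image.1 (Finset.mem_coe.1 hn)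
    obtain ⟨j', _, rfl⟩ := Finset.mem_image.1 (Finset.mem_coe.1 hn')
    simp only [hqj] at hnn'
    rw [Subtype.ext hnn']
  · have hj := Finset.mem_image_of_mem ρ hp
    exact ⟨q _ hj, Finset.mem_image.2 ⟨⟨_, hj⟩, Finset.mem_attach _ _, rfl⟩, hqj _ hj,
      hmax _ hj p hp rfl⟩

/-- A form of Hall's marriage theorem where the marriage condition has to be checked only for those
finite sets that have a system of distinct representatives after the removal of one point. -/
theorem exists_injOn_of_card_le {ι β : Type*} [DecidableEq ι] [DecidableEq β] (t : ι → Finset β)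
    (ht : ∀ i, (t i).Nonempty) (S : Set ι)
    (h : ∀ F : Finset ι, (F : Set ι) ⊆ S → ∀ i₀ ∈ F, ∀ f : ι → β, (∀ i, f i ∈ t i) →
      Set.InjOn f (F.erase i₀ : Set ι) → F.card ≤ (F.biUnion t).card) :
    ∃ f : ι → β, (∀ i, f i ∈ t i) ∧ Set.InjOn f S := by
  have extend : ∀ T : Set ι, (∀ F : Finset ι, (F : Set ι) ⊆ T → F.card ≤ (F.biUnion t).card) →
      ∃ f : ι → β, (∀ i, f i ∈ t i) ∧ Set.InjOn f T := by
    classical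
    intro T hT
    obtain ⟨g, hg, hgt⟩ := (Finset.all_card_le_biUnion_card_iff_exists_injective
      fun i : T => t i).1 fun F => by
        have := hT (F.map (Function.Embedding.subtype _)) fun i hi => by
          obtain ⟨i, _, rfl⟩ := Finset.mem_map.1 (Finset.mem_coe.1 hi)
          exact i.2
        rwa [Finset.card_map, Finset.map_eq_image, Finset.image_biUnion] at this
    refine ⟨fun i => if hi : i ∈ T then g ⟨i, hi⟩ else (ht i).choose, fun i => ?_,
      fun i hi i' hi' hii' => ?_⟩
    · dsimp only
      split_ifs with hi
      · exact hgt ⟨i, hi⟩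
      · exact (ht i).choose_spec
    · simp only [dif_pos hi, dif_pos hi'] at hii'
      exact congrArg Subtype.val (hg hii')
  refine extend S fun F => ?_
  induction F using Finset.strongInduction with
  | H F ih =>
    intro hF
    rcases F.eq_empty_or_nonempty with rfl | ⟨i₀, hi₀⟩
    · simp
    -- By induction all subsets of `F.erase i₀` satisfy the marriage condition, so Hall's theorem
    -- supplies the representatives that `h` may use.
    · obtain ⟨f, hft, hf⟩ := extend (F.erase i₀ : Set ι) fun F' hF' => by
        have hsub : F' ⊆ F.erase i₀ := by exact_mod_cast hF'
        have hss : F' ⊂ F := lt_of_le_of_lt hsub (Finset.erase_ssubset hi₀)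
        exact ih F' hss ((Finset.coe_subset.2 hss.subset).trans hF)
      exact h F hF i₀ hi₀ f hft hf

end Combinatorics

/-! ### Selecting basis vectors equivalent to a block basic sequence. -/

section Universality

variable {𝕜 : Type*} {X N J M : Type*} [RCLike 𝕜] [AddCommGroup X] [Module 𝕜 X] [Norm X]

open Classical in
/-- The colouring `ρ` splits the family `x` into strongly absolute pieces that are added in the
sense of `ℓ₁`. -/
structure IsL1Decomposition (𝕜 : Type*) {X N J : Type*} [RCLike 𝕜] [AddCommGroup X] [Module 𝕜 X]
    [Norm X] (α : ℝ → ℝ) (L : ℝ) (x : N → X) (ρ : N → J) : Prop where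
  pos : ∀ R > 0, 0 < α R
  one_le : 1 ≤ L
  norm_sum_le : ∀ (A : Finset N) (a : N → 𝕜), Set.InjOn ρ (A : Set N) →
    ‖∑ n ∈ A, a n • x n‖ ≤ ∑ n ∈ A, ‖a n‖
  sum_norm_le_add : ∀ R > 0, ∀ (A : Finset N) (a : N → 𝕜) (D : J → ℝ), (∀ j, 0 ≤ D j) →
    (∀ n ∈ A, ‖a n‖ ≤ D (ρ n)) →
    ∑ n ∈ A, ‖a n‖ ≤ α R * ∑ j ∈ A.image ρ, D j + ‖∑ n ∈ A, a n • x n‖ / R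
  sum_norm_le : ∀ (A : Finset N) (a : N → 𝕜), ∑ n ∈ A, ‖a n‖ ≤ L * ‖∑ n ∈ A, a n • x n‖

variable {α : ℝ → ℝ} {L K κ : ℝ} {x : N → X} {ρ : N → J}

theorem IsL1Decomposition.norm_sum_comp_le (hd : IsL1Decomposition 𝕜 α L x ρ) {π : M → N}
    (hπ : Function.Injective π) {F : Finset M} (hF : Set.InjOn (fun m => ρ (π m)) (F : Set M))
    (c : M → 𝕜) : ‖∑ m ∈ F, c m • x (π m)‖ ≤ ∑ m ∈ F, ‖c m‖ := by
  have h := hd.norm_sum_le (F.map ⟨π, hπ⟩) (Function.extend π c 0) (by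
    intro n hn n' hn' hnn'
    obtain ⟨m, hm, rfl⟩ := Finset.mem_map.1 (Finset.mem_coe.1 hn)
    obtain ⟨m', hm', rfl⟩ := Finset.mem_map.1 (Finset.mem_coe.1 hn')
    exact congrArg π (hF hm hm' hnn'))
  simpa [Finset.sum_map, hπ.extend_apply] using h

/-- In a normalized vector with a bounded functional of value `1` there is a substantial part
which uses each colour once and where the functional is bounded below. -/
theorem IsL1Decomposition.exists_large_part [IsQuasiNormed 𝕜 X]
    (hd : IsL1Decomposition 𝕜 α L x ρ) (hx : IsUnconditionalBasis 𝕜 K x) {C : ℝ} (hC : 1 ≤ C)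
    (s : Finset N) (a b : N → 𝕜) (hab : ∑ n ∈ s, a n * b n = 1) (hb : ∀ n, ‖b n‖ ≤ C)
    (ha : ‖∑ n ∈ s, a n • x n‖ = 1) :
    ∃ G ⊆ s, (∀ n ∈ G, 1 / (4 * α (2 * K * C) * L) ≤ ‖b n‖) ∧
      1 / (4 * α (2 * K * C) * C) ≤ ∑ n ∈ G, ‖a n‖ := by
  classical
  have hK := hx.one_le
  have hL := hd.one_le
  have hR : 0 < 2 * K * C := by positivity
  set A := α (2 * K * C)
  have hA : 0 < A := hd.pos _ hR
  obtain ⟨t, hts, htρ, ht⟩ := s.exists_injOn_max ρ fun n => ‖a n * b n‖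
  have h₁ : ‖∑ n ∈ s, (a n * b n) • x n‖ ≤ K * C := by
    have h := hx.norm_sum_le s (fun n => a n * b n) (fun n => (C : 𝕜) * a n) fun n _ => by
      rw [norm_mul, norm_mul, RCLike.norm_ofReal, abs_of_nonneg (by linarith), mul_comm]
      exact mul_le_mul_of_nonneg_right (hb n) (norm_nonneg _)
    simp only [mul_smul (C : 𝕜)] at h
    rwa [← Finset.smul_sum, IsQuasiNormed.norm_smul, ha, RCLike.norm_ofReal,
      abs_of_nonneg (by linarith), mul_one] at h
  have h₂ : 1 ≤ ∑ n ∈ s, ‖a n * b n‖ := by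
    have := _root_.norm_sum_le s fun n => a n * b n
    rwa [hab, norm_one] at this
  -- The radius `2 * K * C` makes the norm term at most `1 / 2`. Since `t` meets each colour at most
  -- once, the filtered sum is just the largest `‖a n * b n‖` of that colour.
  have h₃ := hd.sum_norm_le_add (2 * K * C) hR s (fun n => a n * b n)
    (fun j => ∑ q ∈ t with ρ q = j, ‖a q * b q‖) (fun j => Finset.sum_nonneg fun _ _ =>
      norm_nonneg _) fun p hp => by
        obtain ⟨q, hq, hqp, hpq⟩ := ht p hp
        exact hpq.trans (Finset.single_le_sum (f := fun q => ‖a q * b q‖)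
          (fun _ _ => norm_nonneg _) (Finset.mem_filter.2 ⟨hq, hqp⟩))
  rw [Finset.sum_fiberwise_of_maps_to fun q hq => Finset.mem_image_of_mem ρ (hts hq)] at h₃
  have h₄ : ‖∑ n ∈ s, (a n * b n) • x n‖ / (2 * K * C) ≤ 1 / 2 := by
    rw [div_le_iff₀ hR]
    linarith
  have h₅ : 1 / (2 * A) ≤ ∑ q ∈ t, ‖a q * b q‖ := by
    rw [div_le_iff₀ (by positivity)]
    linarith
  have h₆ : ∑ q ∈ t, ‖a q‖ ≤ L := by
    have := hd.sum_norm_le s a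
    rw [ha, mul_one] at this
    exact (Finset.sum_le_sum_of_subset_of_nonneg hts fun _ _ _ => norm_nonneg _).trans this
  refine ⟨t.filter fun n => 1 / (4 * A * L) ≤ ‖b n‖, (Finset.filter_subset _ _).trans hts,
    fun n hn => (Finset.mem_filter.1 hn).2, ?_⟩
  rw [← Finset.sum_filter_add_sum_filter_not t fun n => 1 / (4 * A * L) ≤ ‖b n‖] at h₅
  -- As `∑ ‖a n‖ ≤ L` on `t`, discarding small `‖b n‖` loses at most half of the mass `1 / (2 * A)`.
  have h₇ : ∑ n ∈ t with ¬ 1 / (4 * A * L) ≤ ‖b n‖, ‖a n * b n‖ ≤ 1 / (4 * A) :=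
    calc _ ≤ ∑ n ∈ t with ¬ 1 / (4 * A * L) ≤ ‖b n‖, ‖a n‖ * (1 / (4 * A * L)) := by
          refine Finset.sum_le_sum fun n hn => ?_
          rw [norm_mul]
          exact mul_le_mul_of_nonneg_left (not_le.1 (Finset.mem_filter.1 hn).2).le (norm_nonneg _)
      _ ≤ ∑ n ∈ t, ‖a n‖ * (1 / (4 * A * L)) :=
          Finset.sum_le_sum_of_subset_of_nonneg (Finset.filter_subset _ _)
            fun _ _ _ => by positivity
      _ ≤ L * (1 / (4 * A * L)) := by
          rw [← Finset.sum_mul]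
          gcongr
      _ = 1 / (4 * A) := by field_simp
  have h₈ : ∑ n ∈ t with 1 / (4 * A * L) ≤ ‖b n‖, ‖a n * b n‖ ≤
      (∑ n ∈ t with 1 / (4 * A * L) ≤ ‖b n‖, ‖a n‖) * C := by
    rw [Finset.sum_mul]
    refine Finset.sum_le_sum fun n _ => ?_
    rw [norm_mul]
    exact mul_le_mul_of_nonneg_left (hb n) (norm_nonneg _)
  have h₉ : 1 / (2 * A) = 1 / (4 * A) + 1 / (4 * A) := by field_simp; norm_num
  rw [← div_div, div_le_iff₀ (by positivity)]
  linarith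

/-- The coefficients of a linear combination of disjointly supported vectors. -/
theorem exists_blockCoeff {s : M → Finset N} (hs : Pairwise fun m m' => Disjoint (s m) (s m'))
    (a : M → N → 𝕜) (F : Finset M) (c : M → 𝕜) :
    ∃ d : N → 𝕜, ∀ m ∈ F, ∀ n ∈ s m, d n = c m * a m n := by
  classical
  refine ⟨fun n => ∑ m ∈ F, if n ∈ s m then c m * a m n else 0, fun m hm n hn => ?_⟩
  dsimp only
  rw [Finset.sum_eq_single_of_mem m hm fun m' _ hm' => if_neg fun hn' =>
    Finset.disjoint_left.1 (hs hm') hn' hn, if_pos hn]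

theorem sum_block_eq {𝕜 X N M : Type*} [RCLike 𝕜] [AddCommGroup X] [Module 𝕜 X] {x : N → X}
    [DecidableEq N] {s : M → Finset N}
    (hs : Pairwise fun m m' => Disjoint (s m) (s m')) {a : M → N → 𝕜} {y : M → X}
    (hy : ∀ m, y m = ∑ n ∈ s m, a m n • x n) {F : Finset M} {c : M → 𝕜} {d : N → 𝕜}
    (hd : ∀ m ∈ F, ∀ n ∈ s m, d n = c m * a m n) :
    ∑ m ∈ F, c m • y m = ∑ n ∈ F.biUnion s, d n • x n := by
  rw [Finset.sum_biUnion fun m _ m' _ h => hs h]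
  refine Finset.sum_congr rfl fun m hm => ?_
  rw [hy, Finset.smul_sum]
  exact Finset.sum_congr rfl fun n hn => by rw [hd m hm n hn, mul_smul]

theorem le_sum_norm_blockCoeff [DecidableEq N] {s G : M → Finset N}
    (hs : Pairwise fun m m' => Disjoint (s m) (s m')) (hG : ∀ m, G m ⊆ s m) {a : M → N → 𝕜}
    {F : Finset M} {c : M → 𝕜} {d : N → 𝕜} (hd : ∀ m ∈ F, ∀ n ∈ s m, d n = c m * a m n)
    {θ : ℝ} (hθ : ∀ m, θ ≤ ∑ n ∈ G m, ‖a m n‖) :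
    θ * ∑ m ∈ F, ‖c m‖ ≤ ∑ n ∈ F.biUnion G, ‖d n‖ := by
  rw [Finset.sum_biUnion fun m _ m' _ h => (hs h).mono (hG m) (hG m'), Finset.mul_sum]
  refine Finset.sum_le_sum fun m hm => ?_
  rw [Finset.sum_congr rfl fun n hn => by rw [hd m hm n (hG m hn), norm_mul],
    ← Finset.mul_sum, mul_comm]
  exact mul_le_mul_of_nonneg_left (hθ m) (norm_nonneg _)

/-- A block basic sequence with small coefficients admits basis vectors of distinct colours. -/
theorem IsL1Decomposition.exists_injOn_colour [IsQuasiNormed 𝕜 X]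
    (hd : IsL1Decomposition 𝕜 α L x ρ) (hx : IsUnconditionalBasis 𝕜 K x)
    (hn : IsNormalizedFamily x) (hκ0 : 0 < κ) (hκ : ∀ f g : X, ‖f + g‖ ≤ κ * (‖f‖ + ‖g‖))
    {s G : M → Finset N} (hs : Pairwise fun m m' => Disjoint (s m) (s m'))
    (hG : ∀ m, G m ⊆ s m) {a : M → N → 𝕜} {y : M → X}
    (hy : ∀ m, y m = ∑ n ∈ s m, a m n • x n) {θ B R δ : ℝ} (hθ0 : 0 < θ)
    (hθ : ∀ m, θ ≤ ∑ n ∈ G m, ‖a m n‖) (hB : 0 ≤ B) (hR : 0 < R) (hδ : 0 ≤ δ)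
    (hRθ : K * (B * κ) / R ≤ θ / 3) (hδθ : α R * δ ≤ θ / 3)
    (hdom : ∀ π : M → N, (∀ m, π m ∈ G m) → ∀ (F : Finset M) (c : M → 𝕜),
      ‖∑ m ∈ F, c m • y m‖ ≤ B * ‖∑ m ∈ F, c m • x (π m)‖)
    (S : Set M) (hS : ∀ m ∈ S, ∀ n ∈ G m, ‖a m n‖ ≤ δ) :
    ∃ π : M → N, (∀ m, π m ∈ G m) ∧ Set.InjOn (fun m => ρ (π m)) S := by
  classical
  have hK := hx.one_le
  have hne : ∀ m, (G m).Nonempty := fun m => by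
    by_contra h
    have := hθ m
    rw [Finset.not_nonempty_iff_eq_empty.1 h, Finset.sum_empty] at this
    linarith
  have hlift : ∀ f : M → J, (∀ m, f m ∈ (G m).image ρ) →
      ∃ π : M → N, (∀ m, π m ∈ G m) ∧ ∀ m, ρ (π m) = f m := fun f hf => by
    choose π hπ hπf using fun m => Finset.mem_image.1 (hf m)
    exact ⟨π, hπ, hπf⟩
  have hinj : ∀ π : M → N, (∀ m, π m ∈ G m) → Function.Injective π := fun π hπ m m' h => by
    by_contra hmm'
    exact Finset.disjoint_left.1 (hs hmm') (hG m (hπ m)) (h ▸ hG m' (hπ m'))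
  obtain ⟨f, hf, hfS⟩ := exists_injOn_of_card_le (fun m => (G m).image ρ)
    (fun m => (hne m).image ρ) S fun F hF m₀ hm₀ f hf hfF => by
      obtain ⟨π, hπ, hπf⟩ := hlift f hf
      by_contra! hcard
      have hF0 : (0 : ℝ) < F.card := by exact_mod_cast Finset.card_pos.2 ⟨m₀, hm₀⟩
      -- All colours but that of `m₀` are distinct, so one use of the quasi-triangle inequality, at
      -- cost `κ`, gives a linear bound.
      have h₁ : ‖∑ m ∈ F, (1 : 𝕜) • x (π m)‖ ≤ κ * F.card := by
        rw [← Finset.sum_erase_add F _ hm₀]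
        refine (hκ _ _).trans (mul_le_mul_of_nonneg_left ?_ hκ0.le)
        have h := hd.norm_sum_comp_le (hinj π hπ) (F := F.erase m₀) (by simpa only [hπf] using hfF)
          fun _ => 1
        simp only [norm_one, Finset.sum_const, nsmul_eq_mul, mul_one] at h
        rw [one_smul 𝕜 (x (π m₀)), hn]
        have hc : ((F.erase m₀).card : ℝ) + 1 = F.card := by
          exact_mod_cast Finset.card_erase_add_one hm₀
        linarith
      obtain ⟨d, hdF⟩ := exists_blockCoeff hs a F fun _ => 1
      have h₂ : ‖∑ n ∈ F.biUnion G, d n • x n‖ ≤ K * (B * (κ * F.card)) := by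
        refine (hx.norm_sum_subset_le (Finset.biUnion_mono fun m _ => hG m) d).trans ?_
        rw [← sum_block_eq hs hy hdF]
        gcongr
        exact (hdom π hπ F fun _ => 1).trans (mul_le_mul_of_nonneg_left h₁ hB)
      have h₃ := hd.sum_norm_le_add R hR (F.biUnion G) d (fun _ => δ) (fun _ => hδ) fun n hnF => by
        obtain ⟨m, hm, hnm⟩ := Finset.mem_biUnion.1 hnF
        rw [hdF m hm n (hG m hnm), one_mul]
        exact hS m (hF hm) n hnm
      have h₄ := le_sum_norm_blockCoeff hs hG hdF hθ
      simp only [norm_one, Finset.sum_const, nsmul_eq_mul, mul_one] at h₄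
      rw [Finset.sum_const, nsmul_eq_mul, Finset.biUnion_image] at h₃
      have h₅ : α R * ((F.biUnion fun m => (G m).image ρ).card * δ) ≤ θ / 3 * F.card :=
        calc _ = (α R * δ) * (F.biUnion fun m => (G m).image ρ).card := by ring
          _ ≤ θ / 3 * F.card := by
            gcongr
      have h₆ : ‖∑ n ∈ F.biUnion G, d n • x n‖ / R ≤ θ / 3 * F.card :=
        calc _ ≤ K * (B * (κ * F.card)) / R := by gcongr
          _ = K * (B * κ) / R * F.card := by ring
          _ ≤ θ / 3 * F.card := by gcongr
      -- The two terms of `h₃` add up to at most two thirds of `θ * F.card`, against the lower bound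
      -- `h₄`.
      nlinarith [mul_pos hθ0 hF0]
  obtain ⟨π, hπ, hπf⟩ := hlift f hf
  exact ⟨π, hπ, by simpa only [hπf] using hfS⟩

/-- A block basic sequence dominates a selection of basis vectors that have large coefficients off
a set where the colours are distinct. -/
theorem IsL1Decomposition.norm_sum_selection_le [IsQuasiNormed 𝕜 X]
    (hd : IsL1Decomposition 𝕜 α L x ρ) (hx : IsUnconditionalBasis 𝕜 K x)
    (hκ0 : 0 < κ) (hκ : ∀ f g : X, ‖f + g‖ ≤ κ * (‖f‖ + ‖g‖))
    {s : M → Finset N} (hs : Pairwise fun m m' => Disjoint (s m) (s m'))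
    {a : M → N → 𝕜} {y : M → X} (hy : ∀ m, y m = ∑ n ∈ s m, a m n • x n) {θ δ : ℝ} (hθ0 : 0 < θ)
    (hθ : ∀ m, θ ≤ ∑ n ∈ s m, ‖a m n‖) (hδ : 0 < δ) {π : M → N} (hπ : ∀ m, π m ∈ s m)
    {S : Set M} (hS : Set.InjOn (fun m => ρ (π m)) S) (hSδ : ∀ m ∉ S, δ ≤ ‖a m (π m)‖)
    (F : Finset M) (c : M → 𝕜) :
    ‖∑ m ∈ F, c m • x (π m)‖ ≤ κ * (L / θ + K ^ 2 / δ) * ‖∑ m ∈ F, c m • y m‖ := by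
  classical
  have hK := hx.one_le
  have hL := hd.one_le
  have hinj : Function.Injective π := fun m m' h => by
    by_contra hmm'
    exact Finset.disjoint_left.1 (hs hmm') (hπ m) (h ▸ hπ m')
  obtain ⟨d, hdF⟩ := exists_blockCoeff hs a F c
  have hsum := sum_block_eq hs hy hdF
  have h₁ : ‖∑ m ∈ F with m ∈ S, c m • x (π m)‖ ≤ L / θ * ‖∑ m ∈ F, c m • y m‖ := by
    refine (hd.norm_sum_comp_le hinj (hS.mono fun m hm =>
      (Finset.mem_filter.1 (Finset.mem_coe.1 hm)).2) c).trans ?_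
    have h₂ := le_sum_norm_blockCoeff hs (fun m => subset_rfl) hdF hθ
    have h₃ := hd.sum_norm_le (F.biUnion s) d
    rw [← hsum] at h₃
    have h₄ : ∑ m ∈ F with m ∈ S, ‖c m‖ ≤ ∑ m ∈ F, ‖c m‖ :=
      Finset.sum_le_sum_of_subset_of_nonneg (Finset.filter_subset _ _) fun _ _ _ => norm_nonneg _
    rw [div_mul_eq_mul_div, le_div_iff₀ hθ0]
    nlinarith
  -- One factor `K` restricts `∑ c m • y m` to the selected indices, the other replaces the
  -- coefficients there, divided by `δ`, with the `c m` they majorize.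
  have h₂ : ‖∑ m ∈ F with m ∉ S, c m • x (π m)‖ ≤ K ^ 2 / δ * ‖∑ m ∈ F, c m • y m‖ := by
    have h₃ := hx.norm_sum_comp_le hinj (F.filter fun m => m ∉ S) (a := c)
      (b := fun m => ((δ⁻¹ : ℝ) : 𝕜) * d (π m)) fun m hm => by
        obtain ⟨hmF, hmS⟩ := Finset.mem_filter.1 hm
        rw [hdF m hmF _ (hπ m), norm_mul, norm_mul, RCLike.norm_ofReal,
          abs_of_pos (inv_pos.2 hδ), inv_mul_eq_div, le_div_iff₀ hδ]
        exact mul_le_mul_of_nonneg_left (hSδ m hmS) (norm_nonneg _)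
    simp only [mul_smul] at h₃
    rw [← Finset.smul_sum, IsQuasiNormed.norm_smul, RCLike.norm_ofReal,
      abs_of_pos (inv_pos.2 hδ)] at h₃
    have h₄ := hx.norm_sum_subset_le (s := (F.filter fun m => m ∉ S).map ⟨π, hinj⟩)
      (t := F.biUnion s) (fun n hn => by
        obtain ⟨m, hm, rfl⟩ := Finset.mem_map.1 hn
        exact Finset.mem_biUnion.2 ⟨m, (Finset.mem_filter.1 hm).1, hπ m⟩) d
    rw [Finset.sum_map, ← hsum] at h₄
    calc _ ≤ _ := h₃
      _ ≤ K * (δ⁻¹ * (K * ‖∑ m ∈ F, c m • y m‖)) := by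
          gcongr
          exact h₄
      _ = K ^ 2 / δ * ‖∑ m ∈ F, c m • y m‖ := by ring
  rw [← Finset.sum_filter_add_sum_filter_not F fun m => m ∈ S]
  calc _ ≤ κ * (_ + _) := hκ _ _
    _ ≤ κ * (L / θ * ‖∑ m ∈ F, c m • y m‖ + K ^ 2 / δ * ‖∑ m ∈ F, c m • y m‖) := by gcongr
    _ = _ := by ring

theorem ProjectionBound.norm_sum_le [IsQuasiNormed 𝕜 X] {C : ℝ} {y : M → X}
    {ystar : M → X →ₗ[𝕜] 𝕜} (h : ProjectionBound C y ystar) (F : Finset M) (f : X) :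
    ‖∑ m ∈ F, ystar m f • y m‖ ≤ C * ‖f‖ := by
  classical
  by_cases hf : f = 0
  · simp [hf, IsQuasiNormed.norm_zero_eq 𝕜]
  have hf0 : 0 < ‖f‖ := IsQuasiNormed.norm_pos (𝕜 := 𝕜) f hf
  set r : 𝕜 := ((‖f‖⁻¹ : ℝ) : 𝕜)
  have hr : ‖r‖ = ‖f‖⁻¹ := by rw [RCLike.norm_ofReal, abs_of_pos (inv_pos.2 hf0)]
  obtain ⟨g, hg, hgC⟩ := h F (r • f) (by
    rw [IsQuasiNormed.norm_smul, hr, inv_mul_cancel₀ hf0.ne'])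
  have hsum := hg.unique (hasExpansion_sum F fun n hn => Set.indicator_of_notMem (by simpa) _)
  rw [Finset.sum_congr rfl fun m hm => by rw [Set.indicator_of_mem (by simpa using hm)]] at hsum
  simp only [map_smul, smul_eq_mul, mul_smul] at hsum
  rw [hsum, ← Finset.smul_sum, IsQuasiNormed.norm_smul, hr, inv_mul_le_iff₀ hf0] at hgC
  linarith

/-- The projection sends `∑ (c m / ystar m (x (π m))) • x (π m)` to `∑ c m • y m`; unconditionality
removes the denominators at cost `K / δ`. -/
theorem ProjectionBound.norm_sum_le_of_selection [IsQuasiNormed 𝕜 X]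
    (hx : IsUnconditionalBasis 𝕜 K x) {C δ : ℝ} (hC : 0 ≤ C) (hδ : 0 < δ) {y : M → X}
    {ystar : M → X →ₗ[𝕜] 𝕜} (h : ProjectionBound C y ystar) {π : M → N}
    (hπ : Function.Injective π) (hδπ : ∀ m, δ ≤ ‖ystar m (x (π m))‖)
    (hoff : ∀ m m', m' ≠ m → ystar m (x (π m')) = 0) (F : Finset M) (c : M → 𝕜) :
    ‖∑ m ∈ F, c m • y m‖ ≤ C * K / δ * ‖∑ m ∈ F, c m • x (π m)‖ := by
  classical
  have hne : ∀ m, ystar m (x (π m)) ≠ 0 := fun m hm => by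
    have := hδπ m
    rw [hm, norm_zero] at this
    linarith
  have h₁ := h.norm_sum_le F (∑ m ∈ F, (c m / ystar m (x (π m))) • x (π m))
  have h₂ : ∀ m ∈ F, ystar m (∑ m ∈ F, (c m / ystar m (x (π m))) • x (π m)) = c m := by
    intro m hm
    rw [map_sum, Finset.sum_eq_single_of_mem m hm fun m' _ hm' => by
      rw [map_smul, hoff m m' hm', smul_zero], map_smul, smul_eq_mul, div_mul_cancel₀ _ (hne m)]
  rw [Finset.sum_congr rfl fun m hm => by rw [h₂ m hm]] at h₁
  have h₃ := hx.norm_sum_comp_le hπ F (a := fun m => c m / ystar m (x (π m)))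
    (b := fun m => ((δ⁻¹ : ℝ) : 𝕜) * c m) fun m _ => by
      rw [norm_div, norm_mul, RCLike.norm_ofReal, abs_of_pos (inv_pos.2 hδ), inv_mul_eq_div]
      exact div_le_div_of_nonneg_left (norm_nonneg _) hδ (hδπ m)
  simp only [mul_smul] at h₃
  rw [← Finset.smul_sum, IsQuasiNormed.norm_smul, RCLike.norm_ofReal,
    abs_of_pos (inv_pos.2 hδ)] at h₃
  calc _ ≤ _ := h₁
    _ ≤ C * (K * (δ⁻¹ * ‖∑ m ∈ F, c m • x (π m)‖)) := by gcongr
    _ = _ := by ring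

theorem IsL1Decomposition.exists_selection [IsQuasiNormed 𝕜 X]
    (hd : IsL1Decomposition 𝕜 α L x ρ) (hx : IsUnconditionalBasis 𝕜 K x)
    (hn : IsNormalizedFamily x) (hκ0 : 0 < κ) (hκ : ∀ f g : X, ‖f + g‖ ≤ κ * (‖f‖ + ‖g‖))
    {C : ℝ} (hC : 1 ≤ C) : ∃ E : ℝ, 1 ≤ E ∧ ∀ (M : Type w) (y : M → X), IsNormalizedFamily y →
      IsWellComplemented 𝕜 C x y → ∃ π : M → N, (∀ m, π m ∈ vecSupport 𝕜 x (y m)) ∧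
        ∀ (F : Finset M) (c : M → 𝕜),
          ‖∑ m ∈ F, c m • x (π m)‖ ≤ E * ‖∑ m ∈ F, c m • y m‖ ∧
          ‖∑ m ∈ F, c m • y m‖ ≤ E * ‖∑ m ∈ F, c m • x (π m)‖ := by
  have hK := hx.one_le
  have hL := hd.one_le
  have hA : 0 < α (2 * K * C) := hd.pos _ (by positivity)
  obtain ⟨δ', hδ'⟩ : ∃ δ', δ' = 1 / (4 * α (2 * K * C) * L) := ⟨_, rfl⟩
  obtain ⟨θ, hθ⟩ : ∃ θ, θ = 1 / (4 * α (2 * K * C) * C) := ⟨_, rfl⟩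
  have hδ'0 : 0 < δ' := by rw [hδ']; positivity
  have hθ0 : 0 < θ := by rw [hθ]; positivity
  obtain ⟨B, hB⟩ : ∃ B, B = C * K / δ' := ⟨_, rfl⟩
  have hB0 : 0 < B := by rw [hB]; positivity
  -- `R` and then `δ` are chosen so that each of the two terms in the counting argument takes at
  -- most a third of `θ`. All constants precede `M` and `y`, which is what makes the result uniform.
  obtain ⟨R, hR⟩ : ∃ R, R = 3 * (K * (B * κ)) / θ := ⟨_, rfl⟩
  have hR0 : 0 < R := by rw [hR]; positivity
  have hαR := hd.pos R hR0
  obtain ⟨δ, hδ⟩ : ∃ δ, δ = θ / (3 * α R) := ⟨_, rfl⟩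
  have hδ0 : 0 < δ := by rw [hδ]; positivity
  refine ⟨max 1 (max B (κ * (L / θ + K ^ 2 / δ))), le_max_left _ _, fun M y hy hwell => ?_⟩
  obtain ⟨ystar, hproj, hsupp, hbound⟩ := hwell.exists_good
  obtain ⟨s, hs⟩ : ∃ s : M → Finset N, ∀ m n, n ∈ s m ↔ n ∈ vecSupport 𝕜 x (y m) :=
    ⟨fun m => (hwell.finite_support m).toFinset, fun m n => Set.Finite.mem_toFinset _⟩
  have hys : ∀ m, y m = ∑ n ∈ s m, coeff 𝕜 x (y m) n • x n := fun m => by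
    have h := hx.eq_sum_of_finite_support (hwell.finite_support m)
    rwa [show (hwell.finite_support m).toFinset = s m by ext n; simp [hs]] at h
  have hdisj : Pairwise fun m m' => Disjoint (s m) (s m') := fun m m' h =>
    Finset.disjoint_left.2 fun n hn hn' =>
      Set.disjoint_left.1 (hwell.disjoint_support h) ((hs m n).1 hn) ((hs m' n).1 hn')
  have hpart : ∀ m, ∃ G ⊆ s m, (∀ n ∈ G, δ' ≤ ‖ystar m (x n)‖) ∧
      θ ≤ ∑ n ∈ G, ‖coeff 𝕜 x (y m) n‖ := fun m => by
    rw [hδ', hθ]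
    refine hd.exists_large_part hx hC (s m) _ (fun n => ystar m (x n)) ?_ (fun n => ?_) ?_
    · have h := (hproj.biorthogonal m).1
      rw [hys m, map_sum] at h
      simpa only [map_smul, smul_eq_mul] using h
    · have h := hbound.norm_sum_le {m} (x n)
      rwa [Finset.sum_singleton, IsQuasiNormed.norm_smul, hy, hn, mul_one, mul_one] at h
    · rw [← hys m, hy]
  choose G hGs hGδ' hGθ using hpart
  have hinj : ∀ π : M → N, (∀ m, π m ∈ G m) → Function.Injective π := fun π hπ m m' h => by
    by_contra hmm'
    exact Finset.disjoint_left.1 (hdisj hmm') (hGs m (hπ m)) (h ▸ hGs m' (hπ m'))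
  have hdom : ∀ π : M → N, (∀ m, π m ∈ G m) → ∀ (F : Finset M) (c : M → 𝕜),
      ‖∑ m ∈ F, c m • y m‖ ≤ B * ‖∑ m ∈ F, c m • x (π m)‖ := fun π hπ F c => by
    rw [hB]
    refine hbound.norm_sum_le_of_selection hx (by linarith) hδ'0 (hinj π hπ)
      (fun m => hGδ' m _ (hπ m)) (fun m m' hmm' => ?_) F c
    by_contra h
    exact Finset.disjoint_left.1 (hdisj hmm') (hGs m' (hπ m')) ((hs m _).2 (hsupp m h))
  obtain ⟨π₀, hπ₀, hπ₀inj⟩ := hd.exists_injOn_colour hx hn hκ0 hκ hdisj hGs hys hθ0 hGθ hB0.le hR0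
    hδ0.le (by rw [hR]; apply le_of_eq; field_simp) (by rw [hδ]; apply le_of_eq; field_simp)
    hdom {m | ∀ n ∈ G m, ‖coeff 𝕜 x (y m) n‖ ≤ δ} fun m hm => hm
  -- Flat blocks keep the Hall selection; any other block takes an index with coefficient above `δ`.
  have hπ : ∀ m, ∃ n ∈ G m, ((∀ n ∈ G m, ‖coeff 𝕜 x (y m) n‖ ≤ δ) → n = π₀ m) ∧
      ((¬ ∀ n ∈ G m, ‖coeff 𝕜 x (y m) n‖ ≤ δ) → δ ≤ ‖coeff 𝕜 x (y m) n‖) := fun m => by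
    by_cases hm : ∀ n ∈ G m, ‖coeff 𝕜 x (y m) n‖ ≤ δ
    · exact ⟨π₀ m, hπ₀ m, fun _ => rfl, fun h => absurd hm h⟩
    · have hm' := hm
      push Not at hm'
      obtain ⟨n, hnG, hnδ⟩ := hm'
      exact ⟨n, hnG, fun h => absurd h hm, fun _ => hnδ.le⟩
  choose π hπG hπeq hπδ using hπ
  refine ⟨π, fun m => (hs m _).1 (hGs m (hπG m)), fun F c => ⟨?_, ?_⟩⟩
  · refine (hd.norm_sum_selection_le hx hκ0 hκ hdisj hys hθ0 (fun m => (hGθ m).trans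
      (Finset.sum_le_sum_of_subset_of_nonneg (hGs m) fun _ _ _ => norm_nonneg _)) hδ0
      (fun m => hGs m (hπG m)) (S := {m | ∀ n ∈ G m, ‖coeff 𝕜 x (y m) n‖ ≤ δ})
      (fun m hm m' hm' h => hπ₀inj hm hm' ?_) hπδ F c).trans
      (mul_le_mul_of_nonneg_right ((le_max_right _ _).trans (le_max_right _ _))
        (IsQuasiNormed.norm_nonneg' 𝕜 _))
    simpa only [hπeq m hm, hπeq m' hm'] using h
  · exact (hdom π hπG F c).trans (mul_le_mul_of_nonneg_right
      ((le_max_left _ _).trans (le_max_right _ _)) (IsQuasiNormed.norm_nonneg' 𝕜 _))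

theorem IsL1Decomposition.isUniformlyUniversal {𝕜 : Type*} {X N J : Type*} [RCLike 𝕜]
    [AddCommGroup X] [Module 𝕜 X] [Norm X] [IsQuasiBanach 𝕜 X] {α : ℝ → ℝ} {L K : ℝ} {x : N → X}
    {ρ : N → J} (hd : IsL1Decomposition 𝕜 α L x ρ) (hx : IsUnconditionalBasis 𝕜 K x)
    (hn : IsNormalizedFamily x) : IsUniformlyUniversal.{w} 𝕜 x := by
  obtain ⟨κ, hκ1, hκ⟩ := IsQuasiNormed.exists_concavity (𝕜 := 𝕜) (X := X)
  have hκ0 : 0 < κ := by linarith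
  have h := fun (C : ℝ) (hC : 1 ≤ C) => hd.exists_selection.{w} hx hn hκ0 hκ hC
  choose! E hE1 hE using h
  refine ⟨fun C => κ ^ 2 * E C, fun C hC => ?_, fun C hC M _ y hy hwell => ?_⟩
  · nlinarith [one_le_pow₀ hκ1 (n := 2), hE1 C hC]
  · obtain ⟨π, hπ, hπE⟩ := hE C hC M y hy hwell
    exact ⟨π, hπ, areEquivalent_of_finite_sums hκ1 (hE1 C hC) hκ hκ hπE⟩

end Universality

theorem l1SumBasis_isL1Decomposition {𝕜 : Type*} [RCLike 𝕜] {J : Type*} {N : J → Type*}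
    {X : J → Type*} [∀ j, AddCommGroup (X j)] [∀ j, Module 𝕜 (X j)] [∀ j, Norm (X j)]
    [∀ j, IsQuasiNormed 𝕜 (X j)] {κ K : ℝ} (hκ : ∀ j, modulusOfConcavity (X j) ≤ κ)
    {x : ∀ j, N j → X j} (hx : ∀ j, IsUnconditionalBasis 𝕜 K (x j))
    (hn : ∀ j, IsNormalizedFamily (x j)) {α : ℝ → ℝ} (hα : ∀ j, IsStronglyAbsolute 𝕜 α (x j)) :
    IsL1Decomposition 𝕜 (fun R => max (α R) 1) (max (α 1 * K) 1) (l1SumBasis 𝕜 hκ x)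
      Sigma.fst where
  -- For empty `J` nothing forces `α` to be positive, whence the maximum with `1`; enlarging `α`
  -- only weakens the estimate.
  pos := fun _ _ => lt_max_of_lt_right one_pos
  one_le := le_max_right _ _
  norm_sum_le := fun A a hA => l1SumBasis_norm_sum_le hκ hn A hA a
  sum_norm_le_add := fun R hR A a D hD0 hD => by
    classical
    refine (l1SumBasis_sum_norm_le_add hκ hx hn hα hR A a D hD0 hD).trans ?_
    exact add_le_add_left (mul_le_mul_of_nonneg_right (le_max_left _ _)
      (Finset.sum_nonneg fun j _ => hD0 j)) _
  sum_norm_le := fun A a => l1SumBasis_sum_norm_le hκ hx hn hα A a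

theorem mainTheorem3 {𝕜 : Type*} [RCLike 𝕜] {J : Type*} [Countable J]
    {N : J → Type*} [∀ j, Countable (N j)]
    {X : J → Type*} [∀ j, AddCommGroup (X j)] [∀ j, Module 𝕜 (X j)] [∀ j, Norm (X j)]
    [∀ j, IsQuasiBanach 𝕜 (X j)]
    (K κ : ℝ) (hK : 1 ≤ K) (hκ : ∀ j, modulusOfConcavity (X j) ≤ κ)
    (x : ∀ j, N j → X j)
    (hbasis : ∀ j, IsUnconditionalBasis 𝕜 K (x j))
    (hnorm : ∀ j, IsNormalizedFamily (x j))
    (α : ℝ → ℝ) (hα : ∀ j, IsStronglyAbsolute 𝕜 α (x j)) :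
    IsQuasiBanach 𝕜 (l1Sum 𝕜 X κ hκ) ∧
    IsUnconditionalBasis 𝕜 K (l1SumBasis 𝕜 hκ x) ∧
    IsNormalizedFamily (l1SumBasis 𝕜 hκ x) ∧
    IsUniformlyUniversal.{w} 𝕜 (l1SumBasis 𝕜 hκ x) := by
  have hX := l1Sum_isQuasiBanach (𝕜 := 𝕜) hκ
  have hx := l1SumBasis_isUnconditionalBasis hκ hK hbasis
  have hn := l1SumBasis_isNormalized (𝕜 := 𝕜) hκ hnorm
  exact ⟨hX, hx, hn,
    (l1SumBasis_isL1Decomposition hκ hbasis hnorm hα).isUniformlyUniversal hx hn⟩
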